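/- Let $\mathbf T,\mathbf O,\mathbf I\subset \mathsf{SU}_2$ be a binary tetrahedral, binary octahedral and binary icosahedral subgroup: subgroups $\mathsf G$ of $\mathsf{SU}_2$ with center $\{\mathbf 1,-\mathbf 1\}$ and $\mathbf T/\{\pm\mathbf 1\}\cong \mathsf A_4$, $\mathbf O/\{\pm\mathbf 1\}\cong \mathsf S_4$, $\mathbf I/\{\pm\mathbf 1\}\cong \mathsf A_5$. Let $\mathsf V=\mathbb C^2$ be the natural module and $\mathsf Z_k(\mathsf G)=\mathrm{End}_{\mathsf G}(\mathsf V^{\otimes k})$. Let $L_n$ be the Lucas numbers: $L_0=2$, $L_1=1$, $L_{n+2}=L_{n+1}+L_n$. The irreducible $\mathsf G$-modules $\mathsf G^{\lambda}$ can be labelled (completely, without repetition up to isomorphism) by the nodes $\lambda$ of the following graph, so that $\mathsf G^{0}$ is the trivial module, $\mathsf G^{1}=\mathsf V$, and $\mathsf G^\lambda\otimes\mathsf V\cong\bigoplus_{\mu\text{ adjacent to }\lambda}\mathsf G^\mu$ for all $\lambda$: * for $\mathbf T$ (type $\hat{\mathsf E}_6$): edges $0\!-\!1,\ 1\!-\!2,\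 2\!-\!3^+,\ 3^+\!-\!4^+,\ 2\!-\!3^-,\ 3^-\!-\!4^-$; * for $\mathbf O$ (type $\hat{\mathsf E}_7$): edges $0\!-\!1,\ 1\!-\!2,\ 2\!-\!3,\ 3\!-\!4^-,\ 3\!-\!4^+,\ 4^+\!-\!5,\ 5\!-\!6^+$; * for $\mathbf I$ (type $\hat{\mathsf E}_8$): edges $0\!-\!1,\ 1\!-\!2,\ 2\!-\!3,\ 3\!-\!4,\ 4\!-\!5,\ 5\!-\!6^-,\ 5\!-\!6^+,\ 6^+\!-\!7$. Fix any such labelling, and let $m_k^\lambda$ be the multiplicity of $\mathsf G^\lambda$ in $\mathsf V^{\otimes k}$, so that $\mathsf V^{\otimes k}\cong\bigoplus_\lambda m_k^\lambda\,\mathsf G^\lambda$. For all $k$ in the ranges given below, the irreducible $\mathsf Z_k(\mathsf G)$-modules are, completely and without repetition up to isomorphism, the modules $\mathsf Z_k^\lambda=\mathrm{Hom}_{\mathsf G}(\mathsf G^\lambda,\mathsf V^{\otimes k})$ with $m_k^\lambda\neq0$; $\dim\mathsf Z_k^\lambda=m_k^\lambda$ for all $\lambda$; and the numbers $m_k^\lambda$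 are as follows, where $m_k^\lambda=0$ for every node $\lambda$ that is not listed for the given parity of $k$. (a) For $k\ge1$, $\dim\mathsf Z_k(\mathbf T)=\frac{4^k+8}{12}$. For $k\ge2$: * $k=2n$: $m_k^{0}=\frac{4^n+8}{12}$, $m_k^{2}=\frac{3\cdot4^n}{12}$, $m_k^{4^+}=m_k^{4^-}=\frac{4^n-4}{12}$; * $k=2n+1$: $m_k^{1}=\frac{4^{n+1}+8}{12}$, $m_k^{3^+}=m_k^{3^-}=\frac{4^{n+1}-4}{12}$. (b) For $k\ge1$, $\dim\mathsf Z_k(\mathbf O)=\frac{4^k+6\cdot2^k+8}{24}$. For $k\ge2$: * $k=2n$: $m_k^{0}=\frac{4^n+6\cdot2^n+8}{24}$, $m_k^{2}=\frac{3\cdot4^n+6\cdot2^n}{24}$, $m_k^{4^-}=\frac{2\cdot4^n-8}{24}$, $m_k^{4^+}=\frac{3\cdot4^n-6\cdot2^n}{24}$, $m_k^{6^+}=\frac{4^n-6\cdot2^n+8}{24}$; * $k=2n+1$: $m_k^{1}=\frac{4^{n+1}+6\cdot2^{n+1}+8}{24}$, $m_k^{3}=\frac{2\cdot4^{n+1}-8}{24}$,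 $m_k^{5}=\frac{4^{n+1}-6\cdot2^{n+1}+8}{24}$. (c) For $k\ge1$, $\dim\mathsf Z_k(\mathbf I)=\frac{4^k+12L_{2k}+20}{60}$. For $k\ge6$: * $k=2n$: $m_k^{0}=\frac{4^n+12L_{2n}+20}{60}$, $m_k^{2}=\frac{3\cdot4^n+12L_{2n+1}}{60}$, $m_k^{4}=\frac{5\cdot4^n-20}{60}$, $m_k^{6^-}=\frac{3\cdot4^n-12L_{2n-1}}{60}$, $m_k^{6^+}=\frac{4\cdot4^n-12L_{2n}+20}{60}$; * $k=2n+1$: $m_k^{1}=\frac{4^{n+1}+12L_{2n+2}+20}{60}$, $m_k^{3}=\frac{2\cdot4^{n+1}+12L_{2n+1}-20}{60}$, $m_k^{5}=\frac{3\cdot4^{n+1}-12L_{2n+1}}{60}$, $m_k^{7}=\frac{4^{n+1}-12L_{2n}+20}{60}$. -/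

import Mathlib

noncomputable section

namespace McKay

/-- The group `SU₂`. -/
abbrev SU2 : Type := Matrix.specialUnitaryGroup (Fin 2) ℂ

/-- `G` is a double cover of the group `P`: the center of `G` is `{1, -1}`, and modulo its center
`G` is isomorphic to `P`. -/
def IsDoubleCover (G : Subgroup SU2) (P : Type) [Group P] : Prop :=
  (fun g : G => ((g : SU2) : Matrix (Fin 2) (Fin 2) ℂ)) '' (Subgroup.center G : Set G) = {1, -1} ∧
    Nonempty (G ⧸ Subgroup.center G ≃* P)

/-- The binary tetrahedral subgroups of `SU₂` (they form one conjugacy class of subgroups). -/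
def IsBinaryTetrahedral (G : Subgroup SU2) : Prop := IsDoubleCover G (alternatingGroup (Fin 4))

/-- The binary octahedral subgroups of `SU₂` (they form one conjugacy class of subgroups). -/
def IsBinaryOctahedral (G : Subgroup SU2) : Prop := IsDoubleCover G (Equiv.Perm (Fin 4))

/-- The binary icosahedral subgroups of `SU₂` (they form one conjugacy class of subgroups). -/
def IsBinaryIcosahedral (G : Subgroup SU2) : Prop := IsDoubleCover G (alternatingGroup (Fin 5))

/-- The natural module `V = ℂ²`, on which `G ≤ SU₂` acts by matrix multiplication. -/
def natural (G : Subgroup SU2) : Representation ℂ G (Fin 2 → ℂ) where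
  toFun g := Matrix.toLin' ((g : SU2) : Matrix (Fin 2) (Fin 2) ℂ)
  map_one' := Matrix.toLin'_one
  map_mul' _ _ := Matrix.toLin'_mul _ _

/-- The underlying space of `V^{⊗k}`. -/
def TensorSpace (k : ℕ) : Type := PiTensorProduct ℂ (fun _ : Fin k => Fin 2 → ℂ)

instance (k : ℕ) : AddCommGroup (TensorSpace k) :=
  inferInstanceAs (AddCommGroup (PiTensorProduct ℂ (fun _ : Fin k => Fin 2 → ℂ)))

instance (k : ℕ) : Module ℂ (TensorSpace k) :=
  inferInstanceAs (Module ℂ (PiTensorProduct ℂ (fun _ : Fin k => Fin 2 → ℂ)))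

/-- The diagonal action of `G` on `V^{⊗k}`. -/
def tensorPower (G : Subgroup SU2) (k : ℕ) : Representation ℂ G (TensorSpace k) where
  toFun g := show TensorSpace k →ₗ[ℂ] TensorSpace k from
    PiTensorProduct.map (fun _ : Fin k => natural G g)
  map_one' := by
    simp only [map_one]
    exact PiTensorProduct.map_one
  map_mul' g h := by
    simp only [map_mul]
    exact PiTensorProduct.map_mul _ _

/-- The centralizer algebra `Z_k(G) = End_G(V^{⊗k})`. -/
abbrev centralizerAlgebra (G : Subgroup SU2) (k : ℕ) :
    Subalgebra ℂ (Module.End ℂ (TensorSpace k)) :=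
  Subalgebra.centralizer ℂ (Set.range (tensorPower G k))

/-- For a `G`-module `W`, the `Z_k(G)`-module `Hom_G(W, V^{⊗k})`, on which `a ∈ Z_k(G)` acts by
`f ↦ a ∘ f`. -/
def homModule {G : Subgroup SU2} {W : Type} [AddCommGroup W] [Module ℂ W]
    (σ : Representation ℂ G W) (k : ℕ) :
    Submodule (centralizerAlgebra G k) (W →ₗ[ℂ] TensorSpace k) where
  carrier := {f | ∀ (g : G) (w : W), f (σ g w) = tensorPower G k g (f w)}
  zero_mem' := by intro g w; simp
  add_mem' := by
    intro f f' hf hf' g w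
    simp only [LinearMap.add_apply, map_add, hf g w, hf' g w]
  smul_mem' := by
    rintro ⟨a, ha⟩ f hf g w
    have h := LinearMap.congr_fun
      ((Subalgebra.mem_centralizer_iff ℂ).1 ha (tensorPower G k g) ⟨g, rfl⟩) (f w)
    change a (f (σ g w)) = tensorPower G k g (a (f w))
    rw [hf g w]
    exact h.symm

/-- `ρ` is a complete list, without repetition up to isomorphism, of the irreducible `G`-modules,
indexed by the vertices of the graph `Γ` in such a way that `Γ` is the representation graph of `G`
with respect to `V`, the vertex `o` is the trivial module and the vertex `v` is `V`. -/
structure IsLabelling {ι : Type} (G : Subgroup SU2) (Γ : SimpleGraph ι) (o v : ι)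
    (d : ι → ℕ) (ρ : (i : ι) → Representation ℂ G (Fin (d i) → ℂ)) : Prop where
  irreducible : ∀ i, (ρ i).IsIrreducible
  injective : ∀ i j, Nonempty ((ρ i).Equiv (ρ j)) → i = j
  complete : ∀ (W : Type) [AddCommGroup W] [Module ℂ W] (σ : Representation ℂ G W),
    σ.IsIrreducible → ∃ i, Nonempty (σ.Equiv (ρ i))
  trivial : Nonempty ((ρ o).Equiv (Representation.trivial ℂ G ℂ))
  natural : Nonempty ((ρ v).Equiv (natural G))
  tensor : ∀ i, Nonempty (((ρ i).tprod (McKay.natural G)).Equiv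
    (Representation.directSum (fun j : {j // Γ.Adj i j} => ρ j)))

/-- The numbers `q i` are natural numbers `m i` such that:
the irreducible `G`-module `ρ i` has multiplicity `m i` in `V^{⊗k}`, that is,
`V^{⊗k} ≅ ⨁ i, (ρ i)^{m i}` as `G`-modules;
the `Z_k(G)`-modules `Hom_G(ρ i, V^{⊗k})` have dimension `m i`, and those with `m i ≠ 0` are a
complete list, without repetition up to isomorphism, of the irreducible `Z_k(G)`-modules. -/
def HasDimensions {ι : Type} (G : Subgroup SU2) (d : ι → ℕ)
    (ρ : (i : ι) → Representation ℂ G (Fin (d i) → ℂ)) (k : ℕ) (q : ι → ℚ) : Prop :=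
  ∃ m : ι → ℕ, (∀ i, (m i : ℚ) = q i) ∧
    Nonempty ((tensorPower G k).Equiv
      (Representation.directSum (fun x : (i : ι) × Fin (m i) => ρ x.1))) ∧
    (∀ i, Module.finrank ℂ (homModule (ρ i) k) = m i) ∧
    (∀ i, m i ≠ 0 → IsSimpleModule (centralizerAlgebra G k) (homModule (ρ i) k)) ∧
    (∀ i j, m i ≠ 0 → m j ≠ 0 →
      Nonempty (homModule (ρ i) k ≃ₗ[centralizerAlgebra G k] homModule (ρ j) k) → i = j) ∧
    (∀ (M : Type) [AddCommGroup M] [Module (centralizerAlgebra G k) M],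
      IsSimpleModule (centralizerAlgebra G k) M →
        ∃ i, m i ≠ 0 ∧ Nonempty (M ≃ₗ[centralizerAlgebra G k] homModule (ρ i) k))

/-- The Lucas numbers. -/
def lucas : ℕ → ℕ
  | 0 => 2
  | 1 => 1
  | n + 2 => lucas (n + 1) + lucas n

/-! In the names of the nodes, `p` and `m` stand for the superscripts `+` and `-`. -/

/-- The nodes `0, 1, 2, 3⁺, 3⁻, 4⁺, 4⁻` of the affine Dynkin diagram of type `E₆`. -/
inductive TNode
  | n0 | n1 | n2 | n3p | n3m | n4p | n4m

/-- The affine Dynkin diagram of type `E₆`. -/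
def graphT : SimpleGraph TNode :=
  SimpleGraph.fromEdgeSet {s(.n0, .n1), s(.n1, .n2), s(.n2, .n3p), s(.n3p, .n4p),
    s(.n2, .n3m), s(.n3m, .n4m)}

/-- The nodes `0, 1, 2, 3, 4⁺, 4⁻, 5, 6⁺` of the affine Dynkin diagram of type `E₇`. -/
inductive ONode
  | n0 | n1 | n2 | n3 | n4p | n4m | n5 | n6p

/-- The affine Dynkin diagram of type `E₇`. -/
def graphO : SimpleGraph ONode :=
  SimpleGraph.fromEdgeSet {s(.n0, .n1), s(.n1, .n2), s(.n2, .n3), s(.n3, .n4m), s(.n3, .n4p),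
    s(.n4p, .n5), s(.n5, .n6p)}

/-- The nodes `0, 1, 2, 3, 4, 5, 6⁺, 6⁻, 7` of the affine Dynkin diagram of type `E₈`. -/
inductive INode
  | n0 | n1 | n2 | n3 | n4 | n5 | n6p | n6m | n7

/-- The affine Dynkin diagram of type `E₈`. -/
def graphI : SimpleGraph INode :=
  SimpleGraph.fromEdgeSet {s(.n0, .n1), s(.n1, .n2), s(.n2, .n3), s(.n3, .n4), s(.n4, .n5),
    s(.n5, .n6m), s(.n5, .n6p), s(.n6p, .n7)}

/-- The dimensions for the binary tetrahedral group and `k = 2n`. -/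
def evenT (n : ℕ) : TNode → ℚ
  | .n0 => (4 ^ n + 8) / 12
  | .n2 => (3 * 4 ^ n) / 12
  | .n4m => (4 ^ n - 4) / 12
  | .n4p => (4 ^ n - 4) / 12
  | .n1 | .n3m | .n3p => 0

/-- The dimensions for the binary tetrahedral group and `k = 2n + 1`. -/
def oddT (n : ℕ) : TNode → ℚ
  | .n1 => (4 ^ (n + 1) + 8) / 12
  | .n3m => (4 ^ (n + 1) - 4) / 12
  | .n3p => (4 ^ (n + 1) - 4) / 12
  | .n0 | .n2 | .n4m | .n4p => 0

/-- The dimensions for the binary octahedral group and `k = 2n`. -/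
def evenO (n : ℕ) : ONode → ℚ
  | .n0 => (4 ^ n + 6 * 2 ^ n + 8) / 24
  | .n2 => (3 * 4 ^ n + 6 * 2 ^ n) / 24
  | .n4m => (2 * 4 ^ n - 8) / 24
  | .n4p => (3 * 4 ^ n - 6 * 2 ^ n) / 24
  | .n6p => (4 ^ n - 6 * 2 ^ n + 8) / 24
  | .n1 | .n3 | .n5 => 0

/-- The dimensions for the binary octahedral group and `k = 2n + 1`. -/
def oddO (n : ℕ) : ONode → ℚ
  | .n1 => (4 ^ (n + 1) + 6 * 2 ^ (n + 1) + 8) / 24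
  | .n3 => (2 * 4 ^ (n + 1) - 8) / 24
  | .n5 => (4 ^ (n + 1) - 6 * 2 ^ (n + 1) + 8) / 24
  | .n0 | .n2 | .n4m | .n4p | .n6p => 0

/-- The dimensions for the binary icosahedral group and `k = 2n`, where `n ≥ 1`. -/
def evenI (n : ℕ) : INode → ℚ
  | .n0 => (4 ^ n + 12 * lucas (2 * n) + 20) / 60
  | .n2 => (3 * 4 ^ n + 12 * lucas (2 * n + 1)) / 60
  | .n4 => (5 * 4 ^ n - 20) / 60
  | .n6m => (3 * 4 ^ n - 12 * lucas (2 * n - 1)) / 60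
  | .n6p => (4 * 4 ^ n - 12 * lucas (2 * n) + 20) / 60
  | .n1 | .n3 | .n5 | .n7 => 0

/-- The dimensions for the binary icosahedral group and `k = 2n + 1`. -/
def oddI (n : ℕ) : INode → ℚ
  | .n1 => (4 ^ (n + 1) + 12 * lucas (2 * n + 2) + 20) / 60
  | .n3 => (2 * 4 ^ (n + 1) + 12 * lucas (2 * n + 1) - 20) / 60
  | .n5 => (3 * 4 ^ (n + 1) - 12 * lucas (2 * n + 1)) / 60
  | .n7 => (4 ^ (n + 1) - 12 * lucas (2 * n) + 20) / 60
  | .n0 | .n2 | .n4 | .n6m | .n6p => 0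

/-- The irreducible `G`-modules can be labelled by the vertices of `Γ` so that `Γ` is the
representation graph; and for every such labelling and every `k ≥ k₀` the multiplicities in
`V^{⊗k}`, and the dimensions of the irreducible `Z_k(G)`-modules, are given by `even n` for
`k = 2n` and by `odd n` for `k = 2n + 1`. -/
def DimensionFormulas {ι : Type} (G : Subgroup SU2) (Γ : SimpleGraph ι) (o v : ι) (k₀ : ℕ)
    (even odd : ℕ → ι → ℚ) : Prop :=
  (∃ (d : ι → ℕ) (ρ : (i : ι) → Representation ℂ G (Fin (d i) → ℂ)), IsLabelling G Γ o v d ρ) ∧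
  ∀ (d : ι → ℕ) (ρ : (i : ι) → Representation ℂ G (Fin (d i) → ℂ)), IsLabelling G Γ o v d ρ →
    (∀ n, k₀ ≤ 2 * n → HasDimensions G d ρ (2 * n) (even n)) ∧
    (∀ n, k₀ ≤ 2 * n + 1 → HasDimensions G d ρ (2 * n + 1) (odd n))

end McKay

end

/-! Everything is read off from characters. Let `χ` be the character of the natural module. In a
labelling, multiplication by `χ` acts on the irreducible characters as the adjacency operator of the
graph, so the multiplicity of a node in `χ ^ k` is the number of walks of length `k` from the
trivial node (`IsLabelling.natural_pow`). The stated formulas satisfy the same recursion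
(`walkCount_eq`). Since `χ` is invariant under inversion, `dim Z_k` is the norm of `χ ^ k`, that is,
the number of closed walks of length `2k`. The simple `Z_k`-modules are found by Maschke and Schur
(`isSimpleModule_homModule`, `nonempty_equiv_of_homModule`, `exists_equiv_homModule`).

The existence of a labelling must be proved knowing only the quotient of `G` by `{1, -1}`. Now `χ ^
2` descends to that quotient, and by Cayley–Hamilton the order of an element restricts its value;
counting elements by order turns the inner products that are needed into averages of polynomials in
`χ ^ 2` (`IsDoubleCover.exists_sq_character` and the three `charInner_eq`). Hence the characters of
the symmetric powers are irreducible up to the branch node, and the next one is a sum of two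
irreducibles. Degree estimates force the rest of the arms (`isIrrChar_branch`).

The list so obtained is complete: weighting each character by its degree gives an eigenvector of
multiplication by `χ` with eigenvalue 2. It is supported at the identity, because no other element
of SU₂ has trace 2, and so no irreducible character is orthogonal to it (`exists_eq_of_isIrrChar`).
-/

noncomputable section

open Representation Module

namespace Representation

/-! ### Isomorphisms, direct sums and their characters. -/

section Transport

variable {k G V W : Type*} [Field k] [Group G] [AddCommGroup V] [Module k V] [AddCommGroup W]
  [Module k W]

/-- Transport of a representation along a linear equivalence. -/
def transport (ρ : Representation k G V) (e : V ≃ₗ[k] W) : Representation k G W where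
  toFun g := e.conj (ρ g)
  map_one' := by ext; simp [LinearEquiv.conj_apply]
  map_mul' g h := by ext; simp [LinearEquiv.conj_apply]

/-- A representation is equivalent to its transports. -/
def transportEquiv (ρ : Representation k G V) (e : V ≃ₗ[k] W) : ρ.Equiv (ρ.transport e) :=
  Equiv.mk e fun g => by ext; simp [transport, LinearEquiv.conj_apply]

theorem Equiv.isIrreducible {ρ : Representation k G V} {σ : Representation k G W}
    (φ : ρ.Equiv σ) (h : ρ.IsIrreducible) : σ.IsIrreducible := by
  rw [irreducible_iff_isSimpleModule_asModule] at h ⊢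
  have e : ρ.asModule ≃ₗ[MonoidAlgebra k G] σ.asModule :=
    LinearEquiv.ofBijective (IntertwiningMap.equivLinearMapAsModule ρ σ φ.toIntertwiningMap)
      φ.toLinearEquiv.bijective
  exact IsSimpleModule.congr e.symm

theorem IsIrreducible.nontrivial' {ρ : Representation k G V} (h : ρ.IsIrreducible) :
    Nontrivial V := by
  rw [irreducible_iff_isSimpleModule_asModule] at h
  exact IsSimpleModule.nontrivial (MonoidAlgebra k G) ρ.asModule

theorem IsIrreducible.finiteDimensional [Finite G] {ρ : Representation k G V}
    (h : ρ.IsIrreducible) : FiniteDimensional k V := by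
  rw [irreducible_iff_isSimpleModule_asModule] at h
  have : Module.Finite k ρ.asModule := Module.Finite.trans (MonoidAlgebra k G) ρ.asModule
  exact this

theorem character_prod [FiniteDimensional k V] [FiniteDimensional k W]
    (ρ : Representation k G V) (σ : Representation k G W) :
    (ρ.prod σ).character = ρ.character + σ.character := by
  ext g
  exact LinearMap.trace_prodMap' (ρ g) (σ g)

section DirectSum

open DirectSum

variable {ι : Type*} [DecidableEq ι] {V : ι → Type*} [∀ i, AddCommGroup (V i)]
    [∀ i, Module k (V i)] (ρ : ∀ i, Representation k G (V i))

/-- The inclusion of a summand into a direct sum of representations. -/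
def directSumOf (i : ι) : IntertwiningMap (ρ i) (directSum ρ) :=
  ⟨lof k ι V i, fun g => by ext v; simp⟩

/-- The projection of a direct sum of representations onto a summand. -/
def directSumComponent (i : ι) : IntertwiningMap (directSum ρ) (ρ i) :=
  ⟨component k ι V i, fun g => by
    ext j v
    simp only [LinearMap.comp_apply, directSum_apply, DirectSum.lmap_lof]
    rcases eq_or_ne j i with rfl | h
    · rw [DirectSum.component.lof_self, DirectSum.component.lof_self]
    · simp only [DirectSum.component.of, dif_neg h, map_zero]⟩

theorem directSumComponent_of (i : ι) (v : V i) :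
    directSumComponent ρ i (directSumOf ρ i v) = v := by
  have h : directSumComponent ρ i (directSumOf ρ i v) =
    component k ι V i (lof k ι V i v) := rfl
  rw [h, DirectSum.component.lof_self]

theorem sum_directSumOf_component [Fintype ι] (v : ⨁ i, V i) :
    ∑ i, directSumOf ρ i (directSumComponent ρ i v) = v := by
  have h (i : ι) : directSumOf ρ i (directSumComponent ρ i v) =
    lof k ι V i (component k ι V i v) := rfl
  simp_rw [h]
  refine DirectSum.ext_component k fun j => ?_
  rw [map_sum, Finset.sum_eq_single j]
  · rw [DirectSum.component.lof_self]
  · intro i _ hi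
    rw [DirectSum.component.of, dif_neg hi]
  · simp

end DirectSum

/-- The action is the sum of inclusion ∘ action ∘ projection over the summands; cyclicity of the
trace reduces each term to the trace on one summand. -/
theorem character_directSum {ι : Type*} [Fintype ι] {V : ι → Type*} [∀ i, AddCommGroup (V i)]
    [∀ i, Module k (V i)] [∀ i, FiniteDimensional k (V i)] (ρ : ∀ i, Representation k G (V i)) :
    (directSum ρ).character = ∑ i, (ρ i).character := by
  classical
  ext g
  have key : directSum ρ g = ∑ i, ((directSumOf ρ i).toLinearMap ∘ₗ ρ i g) ∘ₗ
      (directSumComponent ρ i).toLinearMap := by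
    refine LinearMap.ext fun v => ?_
    rw [← sum_directSumOf_component ρ (directSum ρ g v), LinearMap.sum_apply]
    refine Finset.sum_congr rfl fun i _ => ?_
    rw [IntertwiningMap.isIntertwining]
    rfl
  simp only [character, key, map_sum, Finset.sum_apply]
  refine Finset.sum_congr rfl fun i _ => ?_
  rw [LinearMap.trace_comp_comm']
  congr 1
  ext v
  exact directSumComponent_of ρ i (ρ i g v)

end Transport

/-! ### The inner product of class functions. -/

section CharInner

variable {G : Type*} [Group G]

/-- The bilinear inner product of functions on a finite group, for which the irreducible characters
are orthonormal. -/
def charInner [Fintype G] (f h : G → ℂ) : ℂ := (Nat.card G : ℂ)⁻¹ * ∑ g, f g * h g⁻¹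

variable [Fintype G]

theorem charInner_comm (f h : G → ℂ) : charInner f h = charInner h f := by
  unfold charInner
  rw [← Equiv.sum_comp (Equiv.inv G)]
  simp [mul_comm]

theorem charInner_add_left (f f' h : G → ℂ) :
    charInner (f + f') h = charInner f h + charInner f' h := by
  simp [charInner, add_mul, Finset.sum_add_distrib, mul_add]

theorem charInner_add_right (f h h' : G → ℂ) :
    charInner f (h + h') = charInner f h + charInner f h' := by
  simp [charInner, mul_add, Finset.sum_add_distrib]

@[simp]
theorem charInner_zero_left (h : G → ℂ) : charInner 0 h = 0 := by simp [charInner]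

theorem charInner_smul_left (c : ℂ) (f h : G → ℂ) :
    charInner (c • f) h = c * charInner f h := by
  simp only [charInner, Pi.smul_apply, smul_eq_mul, mul_assoc, ← Finset.mul_sum]
  ring

theorem charInner_sum_left {ι : Type*} (s : Finset ι) (f : ι → G → ℂ) (h : G → ℂ) :
    charInner (∑ i ∈ s, f i) h = ∑ i ∈ s, charInner (f i) h := by
  classical
  induction s using Finset.induction_on with
  | empty => simp
  | insert a s ha ih => rw [Finset.sum_insert ha, Finset.sum_insert ha, charInner_add_left, ih]

variable {V W : Type*} [AddCommGroup V] [Module ℂ V] [FiniteDimensional ℂ V] [AddCommGroup W]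
  [Module ℂ W] [FiniteDimensional ℂ W]

theorem charInner_character (ρ : Representation ℂ G V) (σ : Representation ℂ G W) :
    charInner σ.character ρ.character = finrank ℂ (IntertwiningMap ρ σ) := by
  have : Invertible (Nat.card G : ℂ) := invertibleOfNonzero (by simp)
  exact card_inv_mul_sum_char_mul_char_eq_finrank ρ σ

end CharInner

/-! ### Irreducible subrepresentations and Maschke complements. -/

section Decompose

variable {G : Type*} [Group G]
variable {V W : Type*} [AddCommGroup V] [Module ℂ V] [AddCommGroup W] [Module ℂ W]

/-- A nonzero finite-dimensional representation contains an irreducible representation. -/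
theorem exists_isIrreducible_injective [FiniteDimensional ℂ V] [Nontrivial V]
    (ρ : Representation ℂ G V) :
    ∃ (U : Submodule ℂ V) (τ : Representation ℂ G U) (f : IntertwiningMap τ ρ),
      τ.IsIrreducible ∧ Function.Injective f := by
  have htop : (⊤ : Subrepresentation ρ) ≠ ⊥ := fun h =>
    top_ne_bot (congrArg Subrepresentation.toSubmodule h)
  -- A nonzero subrepresentation of least dimension is irreducible: a smaller one inside it would
  -- also be one of `ρ`.
  obtain ⟨U, hU, hmin⟩ := (measure fun U : Subrepresentation ρ =>
    finrank ℂ U.toSubmodule).wf.has_min {U | U ≠ ⊥} ⟨⊤, htop⟩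
  have hU' : U.toSubmodule ≠ ⊥ := fun h => hU (Subrepresentation.toSubmodule_injective h)
  refine ⟨U.toSubmodule, U.toRepresentation, ⟨U.toSubmodule.subtype, fun g => rfl⟩, ?_,
    Subtype.val_injective⟩
  have : Nontrivial (Subrepresentation U.toRepresentation) := by
    refine ⟨⊤, ⊥, fun h => hU' ?_⟩
    have h' : (⊤ : Submodule ℂ U.toSubmodule) = ⊥ := congrArg Subrepresentation.toSubmodule h
    rw [eq_bot_iff]
    intro x hx
    have : (⟨x, hx⟩ : U.toSubmodule) ∈ (⊥ : Submodule ℂ U.toSubmodule) := h' ▸ Submodule.mem_top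
    simpa using this
  refine ⟨fun P => ?_⟩
  by_contra! hP
  let Q : Subrepresentation ρ :=
    { toSubmodule := P.toSubmodule.map U.toSubmodule.subtype
      apply_mem_toSubmodule := by
        rintro g _ ⟨v, hv, rfl⟩
        exact ⟨_, P.apply_mem_toSubmodule g hv, rfl⟩ }
  refine hmin Q (fun h => hP.1 ?_) ?_
  · apply Subrepresentation.toSubmodule_injective
    have h' : P.toSubmodule.map U.toSubmodule.subtype = ⊥ :=
      congrArg Subrepresentation.toSubmodule h
    exact Submodule.map_injective_of_injective Subtype.val_injective
      (h'.trans (Submodule.map_bot _).symm)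
  · change finrank ℂ (P.toSubmodule.map U.toSubmodule.subtype) < finrank ℂ U.toSubmodule
    rw [Submodule.finrank_map_subtype_eq]
    exact Submodule.finrank_lt fun h => hP.2 (Subrepresentation.toSubmodule_injective h)

variable [Finite G]

/-- An injective intertwining map out of a representation of a finite group has a retraction. -/
theorem IntertwiningMap.exists_retraction {ρ : Representation ℂ G V} {σ : Representation ℂ G W}
    (f : IntertwiningMap ρ σ) (hf : Function.Injective f) :
    ∃ r : IntertwiningMap σ ρ, ∀ v, r (f v) = v := by
  have : NeZero (Nat.card G : ℂ) := ⟨by simp [Nat.card_pos.ne']⟩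
  obtain ⟨r, hr⟩ := MonoidAlgebra.exists_leftInverse_of_injective
    (IntertwiningMap.equivLinearMapAsModule ρ σ f) (LinearMap.ker_eq_bot.2 hf)
  exact ⟨(IntertwiningMap.equivLinearMapAsModule σ ρ).symm r, fun v => LinearMap.congr_fun hr v⟩

/-- An injective intertwining map is the inclusion of a direct summand. -/
theorem exists_equiv_prod {ρ : Representation ℂ G V} {σ : Representation ℂ G W}
    (f : IntertwiningMap ρ σ) (hf : Function.Injective f) :
    ∃ (U : Submodule ℂ W) (τ : Representation ℂ G U), Nonempty ((ρ.prod τ).Equiv σ) := by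
  obtain ⟨r, hr⟩ := f.exists_retraction hf
  -- The complement is the kernel of the retraction.
  refine ⟨r.ker.toSubmodule, r.ker.toRepresentation, ⟨?_⟩⟩
  refine Equiv.mk (LinearEquiv.ofBijective
    (f.toLinearMap.coprod r.ker.toSubmodule.subtype) ⟨?_, fun w => ?_⟩) fun g => ?_
  · refine (injective_iff_map_eq_zero _).2 ?_
    rintro ⟨v, w, hw⟩ h
    have hw' : r w = 0 := hw
    have h' : f v + w = 0 := h
    have hv : v = 0 := by simpa [hr, hw'] using congrArg r h'
    subst hv
    simpa using h'
  · refine ⟨(r w, ⟨w - f (r w), ?_⟩), ?_⟩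
    · change r (w - f (r w)) = 0
      simp [hr]
    · change f (r w) + (w - f (r w)) = w
      abel
  · refine LinearMap.ext fun ⟨v, w⟩ => ?_
    change f (ρ g v) + σ g w = σ g (f v + w)
    rw [map_add, IntertwiningMap.isIntertwining]

end Decompose

/-! ### Characters determine representations. -/

section CharacterDetermines

universe u v

variable {G : Type*} [Group G] [Finite G]

/-- A representation of a finite group is determined up to isomorphism by its character. -/
theorem nonempty_equiv_of_character_eq {V : Type u} {W : Type v} [AddCommGroup V] [Module ℂ V]
    [FiniteDimensional ℂ V] [AddCommGroup W] [Module ℂ W] [FiniteDimensional ℂ W]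
    (ρ : Representation ℂ G V) (σ : Representation ℂ G W) (h : ρ.character = σ.character) :
    Nonempty (ρ.Equiv σ) := by
  have : Fintype G := Fintype.ofFinite G
  induction hn : finrank ℂ V using Nat.strong_induction_on generalizing V W with
  | _ n ih =>
  have hdim : finrank ℂ V = finrank ℂ W := by
    have := congrFun h 1
    rwa [char_one, char_one, Nat.cast_inj] at this
  rcases subsingleton_or_nontrivial V with hV | hV
  · have hW : Subsingleton W := by
      rw [← finrank_zero_iff (R := ℂ), ← hdim, finrank_zero_iff]
      exact hV
    exact ⟨Equiv.mk 0 fun g => by ext; exact Subsingleton.elim _ _⟩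
  obtain ⟨S, τ, f, hτ, hf⟩ := exists_isIrreducible_injective ρ
  -- Equal characters give Hom spaces of equal dimension, so the irreducible `τ` inside `ρ` embeds
  -- in `σ` as well; it is split off from both, and induction on the dimension applies to the
  -- complements.
  have hhom : finrank ℂ (IntertwiningMap τ σ) = finrank ℂ (IntertwiningMap τ ρ) := by
    have h1 := charInner_character τ σ
    rw [← h, charInner_character τ ρ] at h1
    exact_mod_cast h1.symm
  have hS : Nontrivial S := hτ.nontrivial'
  have hf0 : f ≠ 0 := by
    rintro rfl
    obtain ⟨x, hx⟩ := exists_ne (0 : S)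
    exact hx (hf (by simp))
  have : Nontrivial (IntertwiningMap τ ρ) := ⟨f, 0, hf0⟩
  have hpos : 0 < finrank ℂ (IntertwiningMap τ σ) := by
    rw [hhom]
    exact finrank_pos
  have := finrank_pos_iff.1 hpos
  obtain ⟨f', hf'⟩ := exists_ne (0 : IntertwiningMap τ σ)
  have hf'inj : Function.Injective f' := (IsIrreducible.injective_or_eq_zero f').resolve_right hf'
  obtain ⟨U, ρ', ⟨e⟩⟩ := exists_equiv_prod f hf
  obtain ⟨U', σ', ⟨e'⟩⟩ := exists_equiv_prod f' hf'inj
  have hchar : ρ'.character = σ'.character := by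
    have h1 := char_iso e
    rw [h, ← char_iso e', character_prod, character_prod] at h1
    exact add_left_cancel h1
  have hlt : finrank ℂ U < n := by
    rw [← hn, ← e.toLinearEquiv.finrank_eq, finrank_prod]
    have : 0 < finrank ℂ S := finrank_pos
    lia
  obtain ⟨φ⟩ := ih _ hlt ρ' σ' hchar rfl
  refine ⟨e.symm.trans (Equiv.trans (Equiv.mk
    ((LinearEquiv.refl ℂ S).prodCongr φ.toLinearEquiv) fun g => ?_) e')⟩
  refine LinearMap.ext fun ⟨v, w⟩ => Prod.ext rfl ?_
  exact IntertwiningMap.isIntertwining ρ' σ' φ.toIntertwiningMap g w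

end CharacterDetermines

/-! ### Irreducible characters as functions, and their detection by norms. -/

section IrreducibleCharacters

variable {G : Type*} [Group G]

/-- The characters of the finite-dimensional complex representations of `G`. -/
def IsChar (f : G → ℂ) : Prop :=
  ∃ (n : ℕ) (ρ : Representation ℂ G (Fin n → ℂ)), ρ.character = f

/-- The characters of the irreducible finite-dimensional complex representations of `G`. -/
def IsIrrChar (f : G → ℂ) : Prop :=
  ∃ (n : ℕ) (ρ : Representation ℂ G (Fin n → ℂ)), ρ.IsIrreducible ∧ ρ.character = f

variable {V : Type*} [AddCommGroup V] [Module ℂ V] [FiniteDimensional ℂ V]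

theorem isChar_character (ρ : Representation ℂ G V) : IsChar ρ.character :=
  ⟨_, ρ.transport (finBasis ℂ V).equivFun, (char_iso (ρ.transportEquiv _)).symm⟩

theorem IsIrreducible.isIrrChar {ρ : Representation ℂ G V} (h : ρ.IsIrreducible) :
    IsIrrChar ρ.character :=
  ⟨_, ρ.transport (finBasis ℂ V).equivFun, (ρ.transportEquiv _).isIrreducible h,
    (char_iso (ρ.transportEquiv _)).symm⟩

theorem IsIrrChar.isChar {f : G → ℂ} (h : IsIrrChar f) : IsChar f :=
  let ⟨n, ρ, _, hρ⟩ := h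
  ⟨n, ρ, hρ⟩

theorem IsChar.add {f h : G → ℂ} (hf : IsChar f) (hh : IsChar h) : IsChar (f + h) := by
  obtain ⟨n, ρ, rfl⟩ := hf
  obtain ⟨m, σ, rfl⟩ := hh
  rw [← character_prod]
  exact isChar_character _

theorem IsChar.mul {f h : G → ℂ} (hf : IsChar f) (hh : IsChar h) : IsChar (f * h) := by
  obtain ⟨n, ρ, rfl⟩ := hf
  obtain ⟨m, σ, rfl⟩ := hh
  rw [← char_tensor]
  exact isChar_character _

theorem IsChar.exists_apply_one {f : G → ℂ} (hf : IsChar f) : ∃ n : ℕ, f 1 = n := by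
  obtain ⟨n, ρ, rfl⟩ := hf
  exact ⟨_, char_one ρ⟩

theorem IsChar.eq_zero {f : G → ℂ} (hf : IsChar f) (h : f 1 = 0) : f = 0 := by
  obtain ⟨n, ρ, rfl⟩ := hf
  rw [char_one, Nat.cast_eq_zero] at h
  ext g
  have := finrank_zero_iff.1 h
  simp [character, Subsingleton.elim (ρ g) 0]

theorem IsIrrChar.apply_one_ne_zero {f : G → ℂ} (hf : IsIrrChar f) : f 1 ≠ 0 := by
  obtain ⟨n, ρ, hρ, rfl⟩ := hf
  have := hρ.nontrivial'
  rw [char_one, Nat.cast_ne_zero]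
  exact finrank_pos.ne'

theorem isIrrChar_of_apply_one_eq_one {f : G → ℂ} (hf : IsChar f) (h : f 1 = 1) :
    IsIrrChar f := by
  obtain ⟨n, ρ, rfl⟩ := hf
  rw [char_one, Nat.cast_eq_one] at h
  refine ⟨n, ρ, ?_, rfl⟩
  have := Module.nontrivial_of_finrank_pos (R := ℂ) (M := Fin n → ℂ) (by lia)
  have hs : IsSimpleModule ℂ (Fin n → ℂ) := isSimpleModule_iff_finrank_eq_one.2 h
  have : Nontrivial (Subrepresentation ρ) :=
    ⟨⊤, ⊥, fun h => top_ne_bot (congrArg Subrepresentation.toSubmodule h)⟩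
  refine ⟨fun P => ?_⟩
  rcases eq_bot_or_eq_top P.toSubmodule with h | h
  · exact Or.inl (Subrepresentation.toSubmodule_injective h)
  · exact Or.inr (Subrepresentation.toSubmodule_injective h)

variable [Fintype G]

theorem IsChar.exists_charInner {f h : G → ℂ} (hf : IsChar f) (hh : IsChar h) :
    ∃ n : ℕ, charInner f h = n := by
  obtain ⟨n, ρ, rfl⟩ := hf
  obtain ⟨m, σ, rfl⟩ := hh
  exact ⟨_, charInner_character _ _⟩

theorem IsIrrChar.charInner_self {f : G → ℂ} (hf : IsIrrChar f) : charInner f f = 1 := by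
  obtain ⟨n, ρ, hρ, rfl⟩ := hf
  rw [charInner_character, IsIrreducible.finrank_intertwiningMap_self, Nat.cast_one]

theorem IsIrrChar.charInner_eq_zero {f h : G → ℂ} (hf : IsIrrChar f) (hh : IsIrrChar h)
    (hne : f ≠ h) : charInner f h = 0 := by
  obtain ⟨n, ρ, hρ, rfl⟩ := hf
  obtain ⟨m, σ, hσ, rfl⟩ := hh
  have : IsEmpty (σ.Equiv ρ) := ⟨fun e => hne (char_iso e).symm⟩
  rw [charInner_character, finrank_zero_of_subsingleton, Nat.cast_zero]

/-- An irreducible constituent can be subtracted from a character. -/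
theorem IsChar.sub {f x : G → ℂ} (hf : IsChar f) (hx : IsIrrChar x) (h : charInner f x ≠ 0) :
    IsChar (f - x) := by
  obtain ⟨n, ρ, rfl⟩ := hf
  obtain ⟨m, τ, hτ, rfl⟩ := hx
  rw [charInner_character, Nat.cast_ne_zero] at h
  have := finrank_pos_iff.1 (Nat.pos_of_ne_zero h)
  obtain ⟨i, hi⟩ := exists_ne (0 : IntertwiningMap τ ρ)
  obtain ⟨U, σ, ⟨e⟩⟩ := exists_equiv_prod i
    ((IsIrreducible.injective_or_eq_zero i).resolve_right hi)
  rw [← char_iso e, character_prod, add_sub_cancel_left]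
  exact isChar_character σ

/-- A nonzero character has an irreducible constituent. -/
theorem IsChar.exists_add {f : G → ℂ} (hf : IsChar f) (h0 : f ≠ 0) :
    ∃ x f', IsIrrChar x ∧ IsChar f' ∧ f = x + f' := by
  obtain ⟨n, ρ, rfl⟩ := hf
  have : Nontrivial (Fin n → ℂ) := by
    by_contra h
    rw [not_nontrivial_iff_subsingleton] at h
    refine h0 (IsChar.eq_zero (isChar_character ρ) ?_)
    rw [char_one, finrank_zero_of_subsingleton, Nat.cast_zero]
  obtain ⟨S, τ, i, hτ, hi⟩ := exists_isIrreducible_injective ρ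
  obtain ⟨U, σ, ⟨e⟩⟩ := exists_equiv_prod i hi
  exact ⟨τ.character, σ.character, hτ.isIrrChar, isChar_character σ, by
    rw [← char_iso e, character_prod]⟩

/-- Expansion of the norm of `x + f'`. All terms are natural numbers, so a small norm bounds the
number of constituents. -/
theorem IsChar.charInner_self_ge {f x f' : G → ℂ} (hx : IsIrrChar x) (hf' : IsChar f')
    (h : f = x + f') :
    ∃ n : ℕ, charInner f f = 1 + 2 * n + charInner f' f' ∧ charInner f' x = n := by
  obtain ⟨n, hn⟩ := hf'.exists_charInner hx.isChar
  refine ⟨n, ?_, hn⟩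
  rw [h, charInner_add_left, charInner_add_right, charInner_add_right, hx.charInner_self,
    charInner_comm x f', hn]
  ring

theorem IsChar.eq_zero_of_charInner_self {f : G → ℂ} (hf : IsChar f) (h : charInner f f = 0) :
    f = 0 := by
  by_contra h0
  obtain ⟨x, f', hx, hf', he⟩ := hf.exists_add h0
  obtain ⟨n, hn, -⟩ := IsChar.charInner_self_ge hx hf' he
  obtain ⟨m, hm⟩ := hf'.exists_charInner hf'
  rw [h, hm] at hn
  norm_cast at hn
  lia

/-- A character of norm `1` is irreducible. -/
theorem IsChar.isIrrChar {f : G → ℂ} (hf : IsChar f) (h : charInner f f = 1) : IsIrrChar f := by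
  have h0 : f ≠ 0 := by
    rintro rfl
    simp at h
  obtain ⟨x, f', hx, hf', he⟩ := hf.exists_add h0
  obtain ⟨n, hn, -⟩ := IsChar.charInner_self_ge hx hf' he
  obtain ⟨m, hm⟩ := hf'.exists_charInner hf'
  rw [h, hm] at hn
  norm_cast at hn
  have : f' = 0 := hf'.eq_zero_of_charInner_self (by rw [hm, Nat.cast_eq_zero]; lia)
  rwa [he, this, add_zero]

/-- A character of norm `2` is the sum of two distinct irreducible characters. -/
theorem IsChar.exists_add_of_charInner_self_eq_two {f : G → ℂ} (hf : IsChar f)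
    (h : charInner f f = 2) : ∃ x y, IsIrrChar x ∧ IsIrrChar y ∧ x ≠ y ∧ f = x + y := by
  have h0 : f ≠ 0 := by
    rintro rfl
    simp at h
  obtain ⟨x, f', hx, hf', he⟩ := hf.exists_add h0
  obtain ⟨n, hn, hnx⟩ := IsChar.charInner_self_ge hx hf' he
  obtain ⟨m, hm⟩ := hf'.exists_charInner hf'
  rw [h, hm] at hn
  norm_cast at hn
  -- From `2 = 1 + 2n + m`. Here `n` is the multiplicity of `x` in `f'`, so `n = 0` also gives
  -- distinctness.
  have hn0 : n = 0 ∧ m = 1 := by lia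
  have hirr := hf'.isIrrChar (by rw [hm, hn0.2, Nat.cast_one])
  refine ⟨x, f', hx, hirr, ?_, he⟩
  rintro rfl
  rw [hx.charInner_self, hn0.1] at hnx
  simp at hnx

end IrreducibleCharacters

end Representation

/-! ### Characters of tensor powers. -/

namespace McKay

variable (G : Subgroup SU2)

instance (k : ℕ) : FiniteDimensional ℂ (TensorSpace k) :=
  inferInstanceAs (FiniteDimensional ℂ (PiTensorProduct ℂ (fun _ : Fin k => Fin 2 → ℂ)))

theorem character_natural (g : G) :
    (natural G).character g = Matrix.trace ((g : SU2) : Matrix (Fin 2) (Fin 2) ℂ) :=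
  Matrix.trace_toLin'_eq _

/-- In the product basis, indexed by functions `κ → n`, the diagonal entries are products of
diagonal entries, and expanding the product of traces gives the same sum. -/
theorem trace_piTensorProduct_map {κ : Type*} [Fintype κ] {n : Type*} [Fintype n] [DecidableEq n]
    (f : κ → (n → ℂ) →ₗ[ℂ] n → ℂ) :
    LinearMap.trace ℂ _ (PiTensorProduct.map f) = ∏ i, LinearMap.trace ℂ _ (f i) := by
  classical
  let b : Basis (κ → n) ℂ (PiTensorProduct ℂ fun _ : κ => n → ℂ) :=
    Basis.piTensorProduct fun _ => Pi.basisFun ℂ n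
  rw [LinearMap.trace_eq_matrix_trace ℂ b]
  simp_rw [LinearMap.trace_eq_matrix_trace ℂ (Pi.basisFun ℂ n), Matrix.trace, Matrix.diag,
    Finset.prod_univ_sum, Fintype.piFinset_univ, LinearMap.toMatrix_apply]
  refine Finset.sum_congr rfl fun p _ => ?_
  rw [Basis.piTensorProduct_apply, PiTensorProduct.map_tprod, Basis.piTensorProduct_repr_tprod_apply]

theorem character_tensorPower (k : ℕ) :
    (tensorPower G k).character = (natural G).character ^ k := by
  ext g
  refine (trace_piTensorProduct_map fun _ : Fin k => natural G g).trans ?_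
  simp [character]

variable {G}

/-! ### Simple modules over the centralizer algebra. -/

section HomModule

variable {W : Type} [AddCommGroup W] [Module ℂ W] (σ : Representation ℂ G W) (k : ℕ)

instance : AddCommGroup (homModule σ k) := Submodule.addCommGroup _

instance : Module (centralizerAlgebra G k) (homModule σ k) := Submodule.module _

instance : SMul (centralizerAlgebra G k) (homModule σ k) := Module.toDistribMulAction.toSMul

/-- The elements of `Hom_G(W, V^{⊗k})` are the intertwining maps. -/
def homModuleEquiv : homModule σ k ≃ₗ[ℂ] IntertwiningMap σ (tensorPower G k) where
  toFun f := ⟨f.1, fun g => LinearMap.ext fun w => f.2 g w⟩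
  invFun f := ⟨f.toLinearMap, fun g w => IntertwiningMap.isIntertwining _ _ f g w⟩
  map_add' _ _ := rfl
  map_smul' _ _ := rfl
  left_inv _ := rfl
  right_inv _ := rfl

/-- The elements of the centralizer algebra are the intertwining maps. -/
def centralizerAlgebraEquiv :
    centralizerAlgebra G k ≃ₗ[ℂ] IntertwiningMap (tensorPower G k) (tensorPower G k) where
  toFun a := ⟨a.1, fun g => ((Subalgebra.mem_centralizer_iff ℂ).1 a.2 _ ⟨g, rfl⟩).symm⟩
  invFun a := ⟨a.toLinearMap, (Subalgebra.mem_centralizer_iff ℂ).2 (by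
    rintro _ ⟨g, rfl⟩
    exact (a.isIntertwining' g).symm)⟩
  map_add' _ _ := rfl
  map_smul' _ _ := rfl
  left_inv _ := rfl
  right_inv _ := rfl

variable {σ k}

/-- An intertwining map out of `V^{⊗k}` followed by an element of `Hom_G(W, V^{⊗k})`, as an element
of the centralizer algebra. -/
def homModuleComp (f : homModule σ k) (r : IntertwiningMap (tensorPower G k) σ) :
    centralizerAlgebra G k :=
  (centralizerAlgebraEquiv k).symm ((homModuleEquiv σ k f).comp r)

theorem injective_of_ne_zero (hσ : σ.IsIrreducible) {f : homModule σ k} (hf : f ≠ 0) :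
    Function.Injective f.1 :=
  (IsIrreducible.injective_or_eq_zero (homModuleEquiv σ k f)).resolve_right
    fun h => hf ((homModuleEquiv σ k).map_eq_zero_iff.1 h)

/-- Every nonzero `f` generates: it is injective by Schur, hence has a retraction `r`, and then `h ∘
r` lies in the centralizer algebra and carries `f` to any given `h`. -/
theorem isSimpleModule_homModule [Finite G] (hσ : σ.IsIrreducible) (h : Nontrivial (homModule σ k)) :
    IsSimpleModule (centralizerAlgebra G k) (homModule σ k) := by
  rw [isSimpleModule_iff_toSpanSingleton_surjective]
  refine ⟨h, fun f hf h => ?_⟩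
  obtain ⟨r, hr⟩ := (homModuleEquiv σ k f).exists_retraction (injective_of_ne_zero hσ hf)
  refine ⟨homModuleComp h r, Subtype.ext (LinearMap.ext fun w => ?_)⟩
  exact congrArg (⇑h.1) (hr w)

/-- The idempotent `f ∘ r` fixes `f`, so by linearity it fixes `φ f`. Therefore `r ∘ φ f` is
nonzero, and by Schur it is an isomorphism. -/
theorem nonempty_equiv_of_homModule [Finite G] {W' : Type} [AddCommGroup W'] [Module ℂ W']
    {σ' : Representation ℂ G W'} (hσ : σ.IsIrreducible) (hσ' : σ'.IsIrreducible)
    (h : Nontrivial (homModule σ k))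
    (φ : homModule σ k ≃ₗ[centralizerAlgebra G k] homModule σ' k) : Nonempty (σ'.Equiv σ) := by
  obtain ⟨f, hf⟩ := exists_ne (0 : homModule σ k)
  obtain ⟨r, hr⟩ := (homModuleEquiv σ k f).exists_retraction (injective_of_ne_zero hσ hf)
  have hfix : (homModuleComp f r • f : homModule σ k) = f := Subtype.ext (LinearMap.ext fun w => congrArg (⇑f.1) (hr w))
  have hφ : (homModuleComp f r • φ f : homModule σ' k) = φ f := by
    rw [← φ.map_smul, hfix]
  let s : IntertwiningMap σ' σ := r.comp (homModuleEquiv σ' k (φ f))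
  rcases IsIrreducible.bijective_or_eq_zero s with hs | hs
  · exact ⟨s.ofBijective hs⟩
  · refine absurd ?_ (φ.map_ne_zero_iff.2 hf)
    rw [← hφ]
    refine Subtype.ext (LinearMap.ext fun w => ?_)
    have : s w = 0 := by rw [hs]; rfl
    exact (congrArg (⇑f.1) this).trans (map_zero _)

/-- Every simple module over the centralizer algebra is isomorphic to one of the modules
`Hom_G(W, V^{⊗k})`, where `W` is an irreducible constituent of `V^{⊗k}`. -/
theorem exists_equiv_homModule [Finite G] {κ : Type} [Fintype κ] {W : κ → Type}
    [∀ x, AddCommGroup (W x)] [∀ x, Module ℂ (W x)] {σ : ∀ x, Representation ℂ G (W x)}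
    (hσ : ∀ x, (σ x).IsIrreducible) (e : (tensorPower G k).Equiv (directSum σ))
    (M : Type) [AddCommGroup M] [Module (centralizerAlgebra G k) M]
    [IsSimpleModule (centralizerAlgebra G k) M] :
    ∃ x, Nonempty (M ≃ₗ[centralizerAlgebra G k] homModule (σ x) k) := by
  classical
  let p (x : κ) : IntertwiningMap (tensorPower G k) (σ x) :=
    (directSumComponent σ x).comp e.toIntertwiningMap
  let i (x : κ) : homModule (σ x) k := (homModuleEquiv (σ x) k).symm
    (e.symm.toIntertwiningMap.comp (directSumOf σ x))
  -- The identity is the sum of the projections onto the irreducible summands, so one of them does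
  -- not annihilate `m`.
  have hsum : ∑ x, homModuleComp (i x) (p x) = 1 := by
    refine Subtype.ext (LinearMap.ext fun t => ?_)
    change (∑ x, homModuleComp (i x) (p x)).1 t = t
    rw [AddSubmonoidClass.coe_finsetSum, LinearMap.sum_apply]
    change ∑ x, e.symm.toLinearEquiv (directSumOf σ x (directSumComponent σ x (e t))) = t
    rw [← map_sum, sum_directSumOf_component]
    exact e.symm_apply_apply t
  have : Nontrivial M := IsSimpleModule.nontrivial (centralizerAlgebra G k) M
  obtain ⟨m, hm⟩ := exists_ne (0 : M)
  obtain ⟨x, hx⟩ : ∃ x, homModuleComp (i x) (p x) • m ≠ 0 := by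
    by_contra! h
    apply hm
    rw [← one_smul (centralizerAlgebra G k) m, ← hsum, Finset.sum_smul]
    exact Finset.sum_eq_zero fun x _ => h x
  -- Evaluation at `m` through the chosen projection is a nonzero map between simple modules.
  let φ : homModule (σ x) k →ₗ[centralizerAlgebra G k] M :=
    { toFun f := homModuleComp f (p x) • m
      map_add' f f' := by
        rw [← add_smul]
        rfl
      map_smul' a f := by
        rw [RingHom.id_apply, ← mul_smul]
        rfl }
  have hφ : φ ≠ 0 := fun h => hx (LinearMap.congr_fun h (i x))
  have hi : Nontrivial (homModule (σ x) k) := ⟨i x, 0, fun h => hx (by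
    change φ (i x) = 0
    rw [h, map_zero])⟩
  have := isSimpleModule_homModule (hσ x) hi
  have hbij := (LinearMap.bijective_or_eq_zero φ).resolve_right hφ
  exact ⟨x, ⟨(LinearEquiv.ofBijective φ hbij).symm⟩⟩

end HomModule

end McKay

/-- The sum of the values of a function at the neighbours of a vertex. -/
def SimpleGraph.neighborSum {ι M : Type*} [Fintype ι] [AddCommMonoid M] (Γ : SimpleGraph ι)
    [DecidableRel Γ.Adj] (f : ι → M) (i : ι) : M :=
  ∑ j, if Γ.Adj i j then f j else 0

theorem SimpleGraph.sum_adj_eq_neighborSum {ι M : Type*} [Fintype ι] [AddCommMonoid M] (Γ : SimpleGraph ι)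
    [DecidableRel Γ.Adj] (f : ι → M) (i : ι) :
    ∑ j : {j // Γ.Adj i j}, f j = Γ.neighborSum f i := by
  rw [SimpleGraph.neighborSum, ← Finset.sum_filter]
  exact (Finset.sum_subtype _ (by simp) f).symm

namespace McKay

/-! ### Traces in SU₂. -/

section SU2

theorem star_mul_self_SU2 (g : SU2) :
    star (g : Matrix (Fin 2) (Fin 2) ℂ) * (g : Matrix (Fin 2) (Fin 2) ℂ) = 1 :=
  Matrix.mem_unitaryGroup_iff'.1 (Matrix.mem_specialUnitaryGroup_iff.1 g.2).1

theorem det_SU2 (g : SU2) : (g : Matrix (Fin 2) (Fin 2) ℂ).det = 1 :=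
  (Matrix.mem_specialUnitaryGroup_iff.1 g.2).2

theorem coe_inv_SU2 (g : SU2) :
    ((g⁻¹ : SU2) : Matrix (Fin 2) (Fin 2) ℂ) = (g : Matrix (Fin 2) (Fin 2) ℂ).adjugate := by
  have h : ((g⁻¹ : SU2) : Matrix (Fin 2) (Fin 2) ℂ) * (g : Matrix (Fin 2) (Fin 2) ℂ) = 1 := by
    rw [← Submonoid.coe_mul, inv_mul_cancel, Submonoid.coe_one]
  have h' : (g : Matrix (Fin 2) (Fin 2) ℂ) * (g : Matrix (Fin 2) (Fin 2) ℂ).adjugate = 1 := by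
    rw [Matrix.mul_adjugate, det_SU2, one_smul]
  exact left_inv_eq_right_inv h h'

theorem trace_inv_SU2 (g : SU2) :
    ((g⁻¹ : SU2) : Matrix (Fin 2) (Fin 2) ℂ).trace = (g : Matrix (Fin 2) (Fin 2) ℂ).trace := by
  rw [coe_inv_SU2, Matrix.trace_fin_two, Matrix.trace_fin_two, Matrix.adjugate_fin_two]
  simp [add_comm]

/-- For unitary `A` of trace 2, the squared Frobenius norm of `A - 1` is `tr (2 - A - A*) = 0`. -/
theorem eq_one_of_trace_eq_two (g : SU2) (h : (g : Matrix (Fin 2) (Fin 2) ℂ).trace = 2) :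
    g = 1 := by
  set A : Matrix (Fin 2) (Fin 2) ℂ := (g : Matrix (Fin 2) (Fin 2) ℂ) with hA
  have hs : A.conjTranspose * A = 1 := star_mul_self_SU2 g
  have ht : A.conjTranspose.trace = 2 := by
    rw [Matrix.trace_conjTranspose, h]
    simp
  have h0 : ((A - 1).conjTranspose * (A - 1)).trace = 0 := by
    rw [Matrix.conjTranspose_sub, Matrix.conjTranspose_one, sub_mul, mul_sub, hs]
    simp [Matrix.trace_sub, h, ht]
  open scoped ComplexOrder in
  rw [Matrix.trace_conjTranspose_mul_self_eq_zero_iff, sub_eq_zero] at h0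
  exact Subtype.ext h0

end SU2

variable {G : Subgroup SU2}

theorem character_natural_inv (g : G) :
    (natural G).character g⁻¹ = (natural G).character g := by
  rw [character_natural, character_natural]
  exact trace_inv_SU2 g

/-- Self-duality of the natural module: multiplication by its character is self-adjoint, so being a
constituent after tensoring with it is a symmetric relation on irreducibles. -/
theorem charInner_mul_natural [Fintype G] (f h : G → ℂ) :
    charInner (f * (natural G).character) h = charInner f (h * (natural G).character) := by
  simp only [charInner, Pi.mul_apply, character_natural_inv]
  congr 1
  exact Finset.sum_congr rfl fun g _ => by ring

theorem character_natural_one : (natural G).character 1 = 2 := by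
  simp [char_one]

/-! ### Completeness of labellings, and multiplicities as walk counts. -/

section Labelling

theorem IsLabelling.charInner_eq {ι : Type} [DecidableEq ι] {Γ : SimpleGraph ι}
    {o v : ι} {d : ι → ℕ} {ρ : (i : ι) → Representation ℂ G (Fin (d i) → ℂ)} [Fintype G]
    (hL : IsLabelling G Γ o v d ρ) (i j : ι) :
    charInner (ρ i).character (ρ j).character = if i = j then 1 else 0 := by
  have hi := (hL.irreducible i).isIrrChar
  have hj := (hL.irreducible j).isIrrChar
  split_ifs with h
  · rw [h, hj.charInner_self]
  · exact hi.charInner_eq_zero hj fun h' => h (hL.injective i j (nonempty_equiv_of_character_eq _ _ h'))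

variable {ι : Type} [Fintype ι] {Γ : SimpleGraph ι} [DecidableRel Γ.Adj] {o v : ι}

/-- A family of characters that is closed under multiplication by the character of the natural
module, in the way prescribed by a graph, exhausts the irreducible characters. -/
theorem exists_eq_of_isIrrChar [Fintype G] {x : ι → G → ℂ} (hirr : ∀ i, IsIrrChar (x i))
    (htensor : ∀ i, x i * (natural G).character = Γ.neighborSum x i) [Nonempty ι]
    {y : G → ℂ} (hy : IsIrrChar y) : ∃ i, y = x i := by
  by_contra! hne
  choose d hd using fun i => (hirr i).isChar.exists_apply_one
  have hd0 (i : ι) : d i ≠ 0 := fun h => (hirr i).apply_one_ne_zero (by rw [hd, h, Nat.cast_zero])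
  -- Evaluation at the identity: the degrees form an eigenvector of the adjacency matrix with
  -- eigenvalue 2.
  have hsum (i : ι) : Γ.neighborSum (fun j => (d j : ℂ)) i = 2 * d i := by
    have h := congrFun (htensor i) 1
    rw [Pi.mul_apply, character_natural_one, hd] at h
    rw [mul_comm, h, SimpleGraph.neighborSum, SimpleGraph.neighborSum, Finset.sum_apply]
    refine Finset.sum_congr rfl fun j _ => ?_
    split_ifs
    · exact (hd j).symm
    · rfl
  set f : G → ℂ := ∑ i, (d i : ℂ) • x i with hf
  have hfχ : f * (natural G).character = (2 : ℂ) • f := by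
    simp_rw [hf, Finset.sum_mul, smul_mul_assoc, htensor, SimpleGraph.neighborSum, Finset.smul_sum]
    rw [Finset.sum_comm]
    refine Finset.sum_congr rfl fun j _ => ?_
    rw [smul_smul, ← hsum, SimpleGraph.neighborSum, Finset.sum_smul]
    refine Finset.sum_congr rfl fun i _ => ?_
    rw [if_congr (Γ.adj_comm i j) rfl rfl]
    split_ifs <;> simp
  -- From `f χ = 2 f`: wherever `f` is nonzero, the trace is 2. Thus `f` is a multiple of the
  -- regular character.
  have hsupp (g : G) (hg : g ≠ 1) : f g = 0 := by
    have h := congrFun hfχ g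
    rw [Pi.mul_apply, Pi.smul_apply, smul_eq_mul, mul_comm] at h
    by_contra h0
    refine hg (Subtype.ext (eq_one_of_trace_eq_two _ ?_))
    rw [← character_natural]
    exact mul_right_cancel₀ h0 h
  have hf1 : f 1 = ((∑ i, d i * d i : ℕ) : ℂ) := by
    rw [hf, Finset.sum_apply]
    push_cast
    exact Finset.sum_congr rfl fun i _ => by rw [Pi.smul_apply, smul_eq_mul, hd]
  -- Orthogonality of `y` to all `x i` contradicts `charInner f y = f 1 * y 1 / |G|`, which is
  -- nonzero.
  have h1 : charInner f y = 0 := by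
    rw [hf, charInner_sum_left]
    refine Finset.sum_eq_zero fun i _ => ?_
    rw [charInner_smul_left, (hirr i).charInner_eq_zero hy (hne i).symm, mul_zero]
  rw [charInner, Finset.sum_eq_single 1 (fun g _ hg => by rw [hsupp g hg, zero_mul]) (by simp),
    hf1, inv_one] at h1
  have hpos : 0 < ∑ i, d i * d i :=
    Finset.sum_pos (fun i _ => Nat.mul_pos (Nat.pos_of_ne_zero (hd0 i)) (Nat.pos_of_ne_zero (hd0 i)))
      Finset.univ_nonempty
  have := hy.apply_one_ne_zero
  have hG : (Nat.card G : ℂ) ≠ 0 := by simp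
  have hpos' : ((∑ i, d i * d i : ℕ) : ℂ) ≠ 0 := Nat.cast_ne_zero.2 hpos.ne'
  simp_all

theorem exists_isLabelling [Finite G] (x : ι → G → ℂ) (hirr : ∀ i, IsIrrChar (x i))
    (hinj : Function.Injective x) (ho : x o = 1) (hv : x v = (natural G).character)
    (htensor : ∀ i, x i * (natural G).character = Γ.neighborSum x i) :
    ∃ (d : ι → ℕ) (ρ : (i : ι) → Representation ℂ G (Fin (d i) → ℂ)), IsLabelling G Γ o v d ρ := by
  have := Fintype.ofFinite G
  have : Nonempty ι := ⟨o⟩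
  choose d ρ hρ hx using hirr
  refine ⟨d, ρ, hρ, fun i j ⟨e⟩ => hinj ?_, fun W _ _ σ hσ => ?_, ?_, ?_, fun i => ?_⟩
  · rw [← hx, ← hx, char_iso e]
  · have := hσ.finiteDimensional
    obtain ⟨i, hi⟩ := exists_eq_of_isIrrChar (fun i => ⟨d i, ρ i, hρ i, hx i⟩) htensor hσ.isIrrChar
    exact ⟨i, nonempty_equiv_of_character_eq _ _ (by rw [hi, hx])⟩
  · apply nonempty_equiv_of_character_eq
    rw [hx, ho]
    ext g
    simp [character]
  · apply nonempty_equiv_of_character_eq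
    rw [hx, hv]
  · apply nonempty_equiv_of_character_eq
    rw [char_tensor, hx, htensor, character_directSum]
    simp_rw [hx]
    exact (Γ.sum_adj_eq_neighborSum x i).symm

variable (Γ o) in
/-- The number of walks of length `k` in a graph from `o` to a given vertex. -/
def walkCount [DecidableEq ι] : ℕ → ι → ℕ
  | 0, i => if i = o then 1 else 0
  | k + 1, i => Γ.neighborSum (walkCount k) i

variable {d : ι → ℕ} {ρ : (i : ι) → Representation ℂ G (Fin (d i) → ℂ)}

theorem IsLabelling.character_mul (hL : IsLabelling G Γ o v d ρ) (i : ι) :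
    (ρ i).character * (McKay.natural G).character = Γ.neighborSum (fun j => (ρ j).character) i := by
  obtain ⟨e⟩ := hL.tensor i
  rw [← char_tensor, char_iso e, character_directSum]
  exact Γ.sum_adj_eq_neighborSum (fun j => (ρ j).character) i

variable [DecidableEq ι]

/-- Each factor moves a constituent to its neighbours, so `k` factors trace the walks of length `k`
starting at the trivial node. -/
theorem IsLabelling.natural_pow (hL : IsLabelling G Γ o v d ρ) (k : ℕ) :
    (McKay.natural G).character ^ k = ∑ i, (walkCount Γ o k i : ℂ) • (ρ i).character := by
  induction k with
  | zero =>
    obtain ⟨e⟩ := hL.trivial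
    rw [pow_zero, Finset.sum_eq_single o _ (by simp), char_iso e]
    · ext g
      simp [walkCount, character]
    · intro i _ hi
      simp [walkCount, hi]
  | succ k ih =>
    simp_rw [pow_succ, ih, Finset.sum_mul, smul_mul_assoc, hL.character_mul,
      SimpleGraph.neighborSum, Finset.smul_sum]
    rw [Finset.sum_comm]
    refine Finset.sum_congr rfl fun j _ => ?_
    rw [walkCount, SimpleGraph.neighborSum, Nat.cast_sum, Finset.sum_smul]
    refine Finset.sum_congr rfl fun i _ => ?_
    rw [if_congr (Γ.adj_comm i j) rfl rfl]
    split_ifs <;> simp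

theorem IsLabelling.charInner_natural_pow [Fintype G] (hL : IsLabelling G Γ o v d ρ) (k : ℕ)
    (i : ι) : charInner ((McKay.natural G).character ^ k) (ρ i).character = walkCount Γ o k i := by
  rw [hL.natural_pow, charInner_sum_left]
  simp [charInner_smul_left, hL.charInner_eq]

theorem IsLabelling.finrank_homModule [Finite G] (hL : IsLabelling G Γ o v d ρ) (k : ℕ) (i : ι) :
    finrank ℂ (homModule (ρ i) k) = walkCount Γ o k i := by
  have := Fintype.ofFinite G
  rw [(homModuleEquiv (ρ i) k).finrank_eq]
  have h := charInner_character (ρ i) (tensorPower G k)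
  rw [character_tensorPower, hL.charInner_natural_pow] at h
  exact_mod_cast h.symm

/-- Invariance under inversion moves all factors to one side: the norm of `χ ^ k` is the inner
product of `χ ^ (2k)` with the trivial character. -/
theorem IsLabelling.finrank_centralizerAlgebra [Finite G] (hL : IsLabelling G Γ o v d ρ) (k : ℕ) :
    finrank ℂ (centralizerAlgebra G k) = walkCount Γ o (2 * k) o := by
  have := Fintype.ofFinite G
  rw [(centralizerAlgebraEquiv k).finrank_eq]
  have h := charInner_character (tensorPower G k) (tensorPower G k)
  have h1 := hL.charInner_natural_pow (2 * k) o
  obtain ⟨e⟩ := hL.trivial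
  have h2 : charInner ((McKay.natural G).character ^ (2 * k)) (ρ o).character =
      charInner (tensorPower G k).character (tensorPower G k).character := by
    rw [char_iso e, character_tensorPower]
    simp only [charInner, Pi.pow_apply, character_natural_inv, two_mul, pow_add]
    simp [character]
  rw [← h2, h1] at h
  exact_mod_cast h.symm

theorem IsLabelling.hasDimensions [Finite G] (hL : IsLabelling G Γ o v d ρ) (k : ℕ) (q : ι → ℚ)
    (hq : ∀ i, (walkCount Γ o k i : ℚ) = q i) : HasDimensions G d ρ k q := by
  have hnt (i : ι) (hi : walkCount Γ o k i ≠ 0) : Nontrivial (homModule (ρ i) k) := by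
    rw [← hL.finrank_homModule] at hi
    exact nontrivial_of_finrank_pos (R := ℂ) (Nat.pos_of_ne_zero hi)
  have hchar : (tensorPower G k).character = (Representation.directSum
      (fun x : (i : ι) × Fin (walkCount Γ o k i) => ρ x.1)).character := by
    rw [character_tensorPower, hL.natural_pow, character_directSum, Fintype.sum_sigma]
    refine Finset.sum_congr rfl fun i _ => ?_
    refine ((Finset.sum_const (ρ i).character).trans ?_).symm
    rw [Finset.card_univ, Fintype.card_fin, Nat.cast_smul_eq_nsmul]
  obtain ⟨e⟩ := nonempty_equiv_of_character_eq _ _ hchar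
  refine ⟨walkCount Γ o k, hq, ⟨e⟩, hL.finrank_homModule k, fun i hi => ?_, fun i j hi hj ⟨φ⟩ => ?_,
    fun M _ _ hM => ?_⟩
  · exact isSimpleModule_homModule (hL.irreducible i) (hnt i hi)
  · exact (hL.injective _ _ (nonempty_equiv_of_homModule (hL.irreducible i) (hL.irreducible j)
      (hnt i hi) φ)).symm
  · obtain ⟨x, hx⟩ := exists_equiv_homModule
      (fun x : (i : ι) × Fin (walkCount Γ o k i) => hL.irreducible x.1) e M
    -- The summand is indexed by an element of `Fin (walkCount Γ o k x.1)`, so this walk count is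
    -- nonzero.
    exact ⟨x.1, (x.2.pos).ne', hx⟩

end Labelling

end McKay

/-! ### Element orders in the groups A₄, S₄ and A₅. -/

/-- The class of a group element according to its order: `1`, `2`, `3`, or another one. -/
def orderClass {P : Type*} [Group P] [DecidableEq P] (p : P) : Fin 4 :=
  if p = 1 then 0 else if p ^ 2 = 1 then 1 else if p ^ 3 = 1 then 2 else 3

theorem orderClass_cases {P : Type*} [Group P] [DecidableEq P] (p : P) :
    (p = 1 ∧ orderClass p = 0) ∨ (p ≠ 1 ∧ p ^ 2 = 1 ∧ orderClass p = 1) ∨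
      (p ≠ 1 ∧ p ^ 3 = 1 ∧ orderClass p = 2) ∨ (p ≠ 1 ∧ p ^ 2 ≠ 1 ∧ orderClass p = 3) := by
  unfold orderClass
  split_ifs <;> simp_all

theorem sum_comp_orderClass {P : Type*} [Group P] [DecidableEq P] [Fintype P] (H : Fin 4 → ℂ) :
    ∑ p : P, H (orderClass p) =
      ∑ v, ((Finset.univ.filter fun p : P => orderClass p = v).card : ℂ) * H v := by
  rw [← Finset.sum_fiberwise Finset.univ (fun p : P => orderClass p)]
  refine Finset.sum_congr rfl fun v _ => ?_
  rw [Finset.sum_congr rfl (g := fun _ => H v) (fun p hp => by rw [(Finset.mem_filter.1 hp).2]),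
    Finset.sum_const, nsmul_eq_mul]

/-- Finite enumeration. The last class is empty for A₄, and consists of the 4-cycles for S₄ and of
the 5-cycles for A₅. -/
theorem card_orderClass_alternatingGroup_four (v : Fin 4) :
    (Finset.univ.filter fun p : alternatingGroup (Fin 4) => orderClass p = v).card =
      ![1, 3, 8, 0] v := by
  decide +kernel +revert

theorem card_orderClass_perm_four (v : Fin 4) :
    (Finset.univ.filter fun p : Equiv.Perm (Fin 4) => orderClass p = v).card =
      ![1, 9, 8, 6] v := by
  decide +kernel +revert

theorem pow_four_perm_four (p : Equiv.Perm (Fin 4)) (h : orderClass p = 3) : p ^ 4 = 1 := by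
  decide +kernel +revert

theorem card_orderClass_alternatingGroup_five (v : Fin 4) :
    (Finset.univ.filter fun p : alternatingGroup (Fin 5) => orderClass p = v).card =
      ![1, 15, 20, 24] v := by
  decide +kernel +revert

theorem pow_five_alternatingGroup_five (p : alternatingGroup (Fin 5)) (h : orderClass p = 3) :
    p ^ 5 = 1 := by
  decide +kernel +revert

/-- The permutation of the alternating group that squares the elements of order `5` and fixes all
others. -/
def squareOrderFive : Equiv.Perm (alternatingGroup (Fin 5)) where
  toFun p := if orderClass p = 3 then p ^ 2 else p
  -- For `p` of order 5, `(p ^ 2) ^ 3 = p`.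
  invFun p := if orderClass p = 3 then p ^ 3 else p
  left_inv := by
    unfold Function.LeftInverse
    decide +kernel
  right_inv := by
    unfold Function.RightInverse Function.LeftInverse
    decide +kernel

namespace McKay

/-! ### Powers of a 2 × 2 matrix of determinant 1 in terms of its trace. -/

section CayleyHamilton

variable {A : Matrix (Fin 2) (Fin 2) ℂ}

theorem sq_of_det_eq_one (h : A.det = 1) : A ^ 2 = A.trace • A - 1 := by
  rw [Matrix.det_fin_two] at h
  ext i j
  fin_cases i <;> fin_cases j <;>
    simp [pow_two, Matrix.mul_apply, Fin.sum_univ_two, Matrix.trace_fin_two, ← h] <;> ring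

theorem pow_three_of_det_eq_one (h : A.det = 1) :
    A ^ 3 = (A.trace ^ 2 - 1) • A - A.trace • 1 := by
  rw [pow_succ, sq_of_det_eq_one h, sub_mul, smul_mul_assoc, ← pow_two, sq_of_det_eq_one h, one_mul]
  module

theorem pow_four_of_det_eq_one (h : A.det = 1) :
    A ^ 4 = (A.trace ^ 3 - 2 * A.trace) • A - (A.trace ^ 2 - 1) • 1 := by
  rw [pow_succ, pow_three_of_det_eq_one h, sub_mul, smul_mul_assoc, ← pow_two,
    sq_of_det_eq_one h, smul_mul_assoc, one_mul]
  module

theorem pow_five_of_det_eq_one (h : A.det = 1) :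
    A ^ 5 = (A.trace ^ 4 - 3 * A.trace ^ 2 + 1) • A - (A.trace ^ 3 - 2 * A.trace) • 1 := by
  rw [pow_succ, pow_four_of_det_eq_one h, sub_mul, smul_mul_assoc, ← pow_two,
    sq_of_det_eq_one h, smul_mul_assoc, one_mul]
  module

theorem trace_sq_of_det_eq_one (h : A.det = 1) : (A ^ 2).trace = A.trace ^ 2 - 2 := by
  rw [sq_of_det_eq_one h, Matrix.trace_sub, Matrix.trace_smul, Matrix.trace_one, smul_eq_mul]
  simp
  ring

/-- If a nonscalar matrix of determinant `1` has a combination with `1` equal to `1` or `-1`, then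
its coefficient vanishes. -/
theorem eq_zero_of_smul_sub_smul_eq (h : A.det = 1) (hA : ¬(A = 1 ∨ A = -1)) {a b : ℂ}
    (hab : a • A - b • 1 = 1 ∨ a • A - b • 1 = -1) : a = 0 := by
  by_contra ha
  -- If `a ≠ 0`, then `A` is a scalar `c`, and `c ^ 2 = det A = 1` leaves only the excluded values.
  obtain ⟨c, hc⟩ : ∃ c : ℂ, A = c • 1 := by
    rcases hab with hab | hab
    · refine ⟨a⁻¹ * (b + 1), ?_⟩
      have : a • A = (b + 1) • 1 := by rw [add_smul, one_smul, ← sub_eq_iff_eq_add', hab]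
      rw [mul_smul, ← this, smul_smul, inv_mul_cancel₀ ha, one_smul]
    · refine ⟨a⁻¹ * (b - 1), ?_⟩
      have : a • A = (b - 1) • 1 := by
        rw [sub_smul, one_smul, sub_eq_add_neg, ← sub_eq_iff_eq_add', hab]
      rw [mul_smul, ← this, smul_smul, inv_mul_cancel₀ ha, one_smul]
  rw [hc, Matrix.det_smul, Matrix.det_one, mul_one, Fintype.card_fin, sq_eq_one_iff] at h
  refine hA (h.imp ?_ ?_) <;> rintro rfl <;> simp [hc]

end CayleyHamilton

/-! ### The distribution of squared traces over a double cover. -/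

section DoubleCover

variable {G : Subgroup SU2} {P : Type} [Group P]

theorem IsDoubleCover.mem_center (hG : IsDoubleCover G P) (g : G) : g ∈ Subgroup.center G ↔
    ((g : SU2) : Matrix (Fin 2) (Fin 2) ℂ) = 1 ∨ ((g : SU2) : Matrix (Fin 2) (Fin 2) ℂ) = -1 := by
  constructor
  · intro h
    have : ((g : SU2) : Matrix (Fin 2) (Fin 2) ℂ) ∈ ({1, -1} : Set _) := hG.1 ▸ ⟨g, h, rfl⟩
    simpa using this
  · intro h
    have : ((g : SU2) : Matrix (Fin 2) (Fin 2) ℂ) ∈ ({1, -1} : Set _) := by simpa using h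
    rw [← hG.1] at this
    obtain ⟨c, hc, hcg⟩ := this
    rwa [← Subtype.ext (Subtype.ext hcg) (a1 := c)]

theorem IsDoubleCover.card_center (hG : IsDoubleCover G P) : Nat.card (Subgroup.center G) = 2 := by
  have hinj : Function.Injective (fun g : G => ((g : SU2) : Matrix (Fin 2) (Fin 2) ℂ)) :=
    fun g h hgh => Subtype.ext (Subtype.ext hgh)
  have h := Set.ncard_image_of_injective (Subgroup.center G : Set G) hinj
  rw [hG.1, Set.ncard_pair] at h
  · exact h.symm
  · intro h
    have := congrFun (congrFun h 0) 0
    norm_num at this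

theorem IsDoubleCover.finite [Finite P] (hG : IsDoubleCover G P) : Finite G := by
  obtain ⟨e⟩ := hG.2
  have : Finite (Subgroup.center G) := Nat.finite_of_card_ne_zero (by rw [hG.card_center]; simp)
  have : Finite (G ⧸ Subgroup.center G) := Finite.of_equiv P e.symm.toEquiv
  exact Finite.of_subgroup_quotient (Subgroup.center G)

/-- The squares of the values of the character of the natural module, as a function on the quotient
of the group by its center. -/
theorem IsDoubleCover.exists_sq_character [Fintype P] [Fintype G] (hG : IsDoubleCover G P) :
    ∃ s : P → ℂ, s 1 = 4 ∧ (∀ p, p ^ 2 = 1 → p ≠ 1 → s p = 0) ∧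
      (∀ p, p ^ 3 = 1 → p ≠ 1 → s p = 1) ∧ (∀ p, p ^ 4 = 1 → p ^ 2 ≠ 1 → s p = 2) ∧
      (∀ p, p ^ 5 = 1 → p ≠ 1 → s p ^ 2 - 3 * s p + 1 = 0) ∧ (∀ p, s (p ^ 2) = (s p - 2) ^ 2) ∧
      ∀ F : ℂ → ℂ, (Nat.card G : ℂ)⁻¹ * ∑ g, F ((natural G).character g ^ 2) =
        (Nat.card P : ℂ)⁻¹ * ∑ p, F (s p) := by
  classical
  obtain ⟨e⟩ := hG.2
  let φ : G →* P := e.toMonoidHom.comp (QuotientGroup.mk' (Subgroup.center G))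
  have hφ : Function.Surjective φ :=
    e.surjective.comp (QuotientGroup.mk'_surjective (Subgroup.center G))
  have hker : φ.ker = Subgroup.center G := by
    ext g
    rw [MonoidHom.mem_ker, ← QuotientGroup.eq_one_iff]
    exact e.map_eq_one_iff
  have hφ1 (g : G) : φ g = 1 ↔ ((g : SU2) : Matrix (Fin 2) (Fin 2) ℂ) = 1 ∨
      ((g : SU2) : Matrix (Fin 2) (Fin 2) ℂ) = -1 := by
    rw [← MonoidHom.mem_ker, hker, hG.mem_center]
  choose sec hsec using hφ
  have hdet (g : G) : ((g : SU2) : Matrix (Fin 2) (Fin 2) ℂ).det = 1 := det_SU2 _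
  have hpow (g : G) (n : ℕ) : (((g ^ n : G) : SU2) : Matrix (Fin 2) (Fin 2) ℂ) =
      ((g : SU2) : Matrix (Fin 2) (Fin 2) ℂ) ^ n := rfl
  -- Two lifts of an element of `P` differ by a sign, which squaring removes.
  have hs (g : G) : (natural G).character (sec (φ g)) ^ 2 = (natural G).character g ^ 2 := by
    have h : φ (sec (φ g) * g⁻¹) = 1 := by rw [map_mul, hsec, map_inv, mul_inv_cancel]
    have hmul : ((sec (φ g) : SU2) : Matrix (Fin 2) (Fin 2) ℂ) =
        (((sec (φ g) * g⁻¹ : G) : SU2) : Matrix (Fin 2) (Fin 2) ℂ) *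
          ((g : SU2) : Matrix (Fin 2) (Fin 2) ℂ) := by
      rw [← Submonoid.coe_mul, ← Subgroup.coe_mul, inv_mul_cancel_right]
    rw [character_natural, character_natural, hmul]
    rcases (hφ1 _).1 h with h | h <;> rw [h] <;> simp
  -- If `p ^ n = 1`, the `n`-th power of a lift is `1` or `-1`. When the lift itself is not, the
  -- coefficient of `A` in the Cayley–Hamilton expression vanishes, and this is a polynomial
  -- equation for the trace.
  have hpow1 (p : P) (n : ℕ) (h : p ^ n = 1) :
      ((sec p : SU2) : Matrix (Fin 2) (Fin 2) ℂ) ^ n = 1 ∨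
        ((sec p : SU2) : Matrix (Fin 2) (Fin 2) ℂ) ^ n = -1 := by
    rw [← hpow, ← hφ1, map_pow, hsec, h]
  have hne (p : P) (h : p ≠ 1) : ¬(((sec p : SU2) : Matrix (Fin 2) (Fin 2) ℂ) = 1 ∨
        ((sec p : SU2) : Matrix (Fin 2) (Fin 2) ℂ) = -1) := by
    rwa [← hφ1, hsec]
  refine ⟨fun p => (natural G).character (sec p) ^ 2, ?_, fun p h h1 => ?_, fun p h h1 => ?_,
    fun p h h1 => ?_, fun p h h1 => ?_, fun p => ?_, fun F => ?_⟩
  · have := hs 1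
    rw [map_one] at this
    change (natural G).character (sec 1) ^ 2 = 4
    rw [this, character_natural_one]
    norm_num
  · have h2 := hpow1 p 2 h
    rw [sq_of_det_eq_one (hdet _), ← one_smul ℂ (1 : Matrix (Fin 2) (Fin 2) ℂ)] at h2
    have := eq_zero_of_smul_sub_smul_eq (hdet _) (hne p h1) (b := 1) (by simpa using h2)
    simp only [character_natural]
    rw [this, zero_pow two_ne_zero]
  · have h2 := hpow1 p 3 h
    rw [pow_three_of_det_eq_one (hdet _)] at h2
    have := eq_zero_of_smul_sub_smul_eq (hdet _) (hne p h1) h2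
    simp only [character_natural]
    linear_combination this
  · have h2 := hpow1 p 4 h
    rw [pow_four_of_det_eq_one (hdet _)] at h2
    have hp1 : p ≠ 1 := by
      rintro rfl
      simp at h1
    have h3 := eq_zero_of_smul_sub_smul_eq (hdet _) (hne p hp1) h2
    simp only [character_natural]
    -- The coefficient is `t (t ^ 2 - 2)`. The factor `t` is excluded because `t = 0` gives `A ^ 2 =
    -- -1`, hence `p ^ 2 = 1`.
    have ht : ((sec p : SU2) : Matrix (Fin 2) (Fin 2) ℂ).trace ≠ 0 := by
      intro ht
      refine hne _ h1 ?_
      rw [← hφ1, hsec, ← hsec p, ← map_pow, hφ1, hpow, sq_of_det_eq_one (hdet _), ht]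
      simp
    refine mul_left_cancel₀ ht ?_
    linear_combination h3
  · have h2 := hpow1 p 5 h
    rw [pow_five_of_det_eq_one (hdet _)] at h2
    have := eq_zero_of_smul_sub_smul_eq (hdet _) (hne p h1) h2
    simp only [character_natural]
    linear_combination this
  · have := hs (sec p ^ 2)
    rw [map_pow, hsec] at this
    change (natural G).character (sec (p ^ 2)) ^ 2 = ((natural G).character (sec p) ^ 2 - 2) ^ 2
    rw [this, character_natural, character_natural, hpow, trace_sq_of_det_eq_one (hdet _)]
  · have hfib (p : P) : (Finset.univ.filter fun g : G => φ g = p).card = 2 := by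
      refine Eq.trans ?_ hG.card_center
      rw [MonoidHom.card_fiber_eq_of_mem_range φ ⟨sec p, hsec p⟩ ⟨1, map_one φ⟩,
        ← hker, Nat.card_eq_fintype_card, Fintype.card_subtype]
      exact congrArg Finset.card (Finset.filter_congr fun g _ => MonoidHom.mem_ker.symm)
    have hsum (F : G → ℂ) (F' : P → ℂ) (h : ∀ g, F g = F' (φ g)) :
        ∑ g, F g = 2 * ∑ p, F' p := by
      rw [← Finset.sum_fiberwise Finset.univ φ, Finset.mul_sum]
      refine Finset.sum_congr rfl fun p _ => ?_
      rw [Finset.sum_congr rfl (g := fun _ => F' p)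
        (fun g hg => by rw [h, (Finset.mem_filter.1 hg).2]), Finset.sum_const, hfib, nsmul_eq_mul]
      norm_num
    have hcard : (Nat.card G : ℂ) = 2 * Nat.card P := by
      have := hsum (fun _ => 1) (fun _ => 1) fun _ => rfl
      simpa using this
    rw [hsum _ (fun p => F ((natural G).character (sec p) ^ 2)) (fun g => by rw [hs]), hcard,
      mul_inv, mul_mul_mul_comm, inv_mul_cancel₀ two_ne_zero, one_mul]

theorem IsBinaryTetrahedral.charInner_eq [Fintype G] (hG : IsBinaryTetrahedral G) {f h : G → ℂ}
    (F : ℂ → ℂ) (hF : ∀ g, f g * h g⁻¹ = F ((natural G).character g ^ 2)) :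
    charInner f h = (F 4 + 3 * F 0 + 8 * F 1) / 12 := by
  obtain ⟨s, h1, h2, h3, -, -, -, hsum⟩ := IsDoubleCover.exists_sq_character hG
  have hs (p : alternatingGroup (Fin 4)) : F (s p) = ![F 4, F 0, F 1, 0] (orderClass p) := by
    rcases orderClass_cases p with ⟨hp, hc⟩ | ⟨hp, hp', hc⟩ | ⟨hp, hp', hc⟩ | ⟨-, -, hc⟩
    · rw [hc, hp, h1]
      rfl
    · simp [hc, h2 p hp' hp]
    · simp [hc, h3 p hp' hp]
    · have := Finset.card_ne_zero_of_mem
        (Finset.mem_filter (p := fun p => orderClass p = 3).2 ⟨Finset.mem_univ p, hc⟩)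
      rw [card_orderClass_alternatingGroup_four] at this
      exact absurd rfl this
  simp_rw [charInner, hF, hsum, hs, sum_comp_orderClass, card_orderClass_alternatingGroup_four]
  have : Nat.card (alternatingGroup (Fin 4)) = 12 := by
    rw [Nat.card_eq_fintype_card]
    decide +kernel
  rw [this]
  simp [Fin.sum_univ_four]
  ring

theorem IsBinaryOctahedral.charInner_eq [Fintype G] (hG : IsBinaryOctahedral G) {f h : G → ℂ}
    (F : ℂ → ℂ) (hF : ∀ g, f g * h g⁻¹ = F ((natural G).character g ^ 2)) :
    charInner f h = (F 4 + 9 * F 0 + 8 * F 1 + 6 * F 2) / 24 := by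
  obtain ⟨s, h1, h2, h3, h4, -, -, hsum⟩ := IsDoubleCover.exists_sq_character hG
  have hs (p : Equiv.Perm (Fin 4)) : F (s p) = ![F 4, F 0, F 1, F 2] (orderClass p) := by
    rcases orderClass_cases p with ⟨hp, hc⟩ | ⟨hp, hp', hc⟩ | ⟨hp, hp', hc⟩ | ⟨-, hp, hc⟩
    · rw [hc, hp, h1]
      rfl
    · simp [hc, h2 p hp' hp]
    · simp [hc, h3 p hp' hp]
    · simp [hc, h4 p (pow_four_perm_four p hc) hp]
  simp_rw [charInner, hF, hsum, hs, sum_comp_orderClass, card_orderClass_perm_four]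
  have : Nat.card (Equiv.Perm (Fin 4)) = 24 := by
    rw [Nat.card_eq_fintype_card]
    decide +kernel
  rw [this]
  simp [Fin.sum_univ_four]
  ring

/-- On elements of order 5 the squared trace `s` is one of the roots `a`, `b` of `s ^ 2 - 3 s + 1`,
and squaring the element replaces `s` by `(s - 2) ^ 2 = 3 - s`, the other root. Averaging with
`squareOrderFive` thus avoids deciding which element has which root. -/
theorem IsBinaryIcosahedral.charInner_eq [Fintype G] (hG : IsBinaryIcosahedral G) {a b : ℂ}
    (hab : a + b = 3) (hab' : a * b = 1) {f h : G → ℂ}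
    (F : ℂ → ℂ) (hF : ∀ g, f g * h g⁻¹ = F ((natural G).character g ^ 2)) :
    charInner f h = (F 4 + 15 * F 0 + 20 * F 1 + 12 * (F a + F b)) / 60 := by
  obtain ⟨s, h1, h2, h3, -, h5, hsq, hsum⟩ := IsDoubleCover.exists_sq_character hG
  have hs (p : alternatingGroup (Fin 5)) : F (s p) + F (s (squareOrderFive p)) =
      ![2 * F 4, 2 * F 0, 2 * F 1, F a + F b] (orderClass p) := by
    have hsq' : squareOrderFive p = if orderClass p = 3 then p ^ 2 else p := rfl
    rcases orderClass_cases p with ⟨hp, hc⟩ | ⟨hp, hp', hc⟩ | ⟨hp, hp', hc⟩ | ⟨hp, -, hc⟩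
    · rw [hsq', hc, if_neg (by decide), hp, h1]
      simp [two_mul]
    · rw [hsq', hc, if_neg (by decide), h2 p hp' hp]
      simp [two_mul]
    · rw [hsq', hc, if_neg (by decide), h3 p hp' hp]
      simp [two_mul]
    · have hp5 := h5 p (pow_five_alternatingGroup_five p hc) hp
      have hp : (s p - a) * (s p - b) = 0 := by
        linear_combination hp5 - s p * hab + hab'
      rw [hsq', hc, if_pos rfl, hsq, show (s p - 2) ^ 2 = 3 - s p by linear_combination hp5, ← hab]
      rcases mul_eq_zero.1 hp with hp | hp
      · simp [sub_eq_zero.1 hp]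
      · simp [sub_eq_zero.1 hp, add_comm]
  have hsum2 : ∑ p, F (s p) = (∑ p, (F (s p) + F (s (squareOrderFive p)))) / 2 := by
    rw [Finset.sum_add_distrib, Equiv.sum_comp squareOrderFive fun p => F (s p)]
    ring
  simp_rw [charInner, hF, hsum, hsum2, hs, sum_comp_orderClass,
    card_orderClass_alternatingGroup_five]
  have : Nat.card (alternatingGroup (Fin 5)) = 60 := by
    rw [Nat.card_eq_fintype_card]
    decide +kernel
  rw [this]
  simp [Fin.sum_univ_four]
  ring

end DoubleCover

end McKay

/-! ### Walk counts on the three diagrams. -/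

namespace McKay

deriving instance DecidableEq for TNode
deriving instance DecidableEq for ONode
deriving instance DecidableEq for INode

instance : Fintype TNode :=
  ⟨{.n0, .n1, .n2, .n3p, .n3m, .n4p, .n4m}, by rintro ⟨⟩ <;> decide⟩

instance : Fintype ONode :=
  ⟨{.n0, .n1, .n2, .n3, .n4p, .n4m, .n5, .n6p}, by rintro ⟨⟩ <;> decide⟩

instance : Fintype INode :=
  ⟨{.n0, .n1, .n2, .n3, .n4, .n5, .n6p, .n6m, .n7}, by rintro ⟨⟩ <;> decide⟩

instance : DecidableRel graphT.Adj := Classical.decRel _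

instance : DecidableRel graphO.Adj := Classical.decRel _

instance : DecidableRel graphI.Adj := Classical.decRel _

/-- The function on the nodes with the given values. -/
def TNode.values {M : Type*} (a0 a1 a2 a3p a3m a4p a4m : M) : TNode → M
  | .n0 => a0 | .n1 => a1 | .n2 => a2 | .n3p => a3p | .n3m => a3m | .n4p => a4p | .n4m => a4m

/-- The function on the nodes with the given values. -/
def ONode.values {M : Type*} (a0 a1 a2 a3 a4p a4m a5 a6p : M) : ONode → M
  | .n0 => a0 | .n1 => a1 | .n2 => a2 | .n3 => a3 | .n4p => a4p | .n4m => a4m | .n5 => a5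
  | .n6p => a6p

/-- The function on the nodes with the given values. -/
def INode.values {M : Type*} (a0 a1 a2 a3 a4 a5 a6p a6m a7 : M) : INode → M
  | .n0 => a0 | .n1 => a1 | .n2 => a2 | .n3 => a3 | .n4 => a4 | .n5 => a5 | .n6p => a6p
  | .n6m => a6m | .n7 => a7

theorem TNode.sum_eq {M : Type*} [AddCommMonoid M] (f : TNode → M) :
    ∑ i, f i = f .n0 + f .n1 + f .n2 + f .n3p + f .n3m + f .n4p + f .n4m := by
  change ∑ i ∈ ({.n0, .n1, .n2, .n3p, .n3m, .n4p, .n4m} : Finset TNode), f i = _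
  simp [add_assoc]

theorem ONode.sum_eq {M : Type*} [AddCommMonoid M] (f : ONode → M) :
    ∑ i, f i = f .n0 + f .n1 + f .n2 + f .n3 + f .n4p + f .n4m + f .n5 + f .n6p := by
  change ∑ i ∈ ({.n0, .n1, .n2, .n3, .n4p, .n4m, .n5, .n6p} : Finset ONode), f i = _
  simp [add_assoc]

theorem INode.sum_eq {M : Type*} [AddCommMonoid M] (f : INode → M) :
    ∑ i, f i = f .n0 + f .n1 + f .n2 + f .n3 + f .n4 + f .n5 + f .n6p + f .n6m + f .n7 := by
  change ∑ i ∈ ({.n0, .n1, .n2, .n3, .n4, .n5, .n6p, .n6m, .n7} : Finset INode), f i = _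
  simp [add_assoc]

theorem neighborSum_graphT {M : Type*} [AddCommMonoid M] (f : TNode → M) :
    graphT.neighborSum f = TNode.values (f .n1) (f .n0 + f .n2) (f .n1 + f .n3p + f .n3m)
      (f .n2 + f .n4p) (f .n2 + f .n4m) (f .n3p) (f .n3m) := by
  ext i
  rw [SimpleGraph.neighborSum, TNode.sum_eq]
  cases i <;> simp [graphT, TNode.values]

theorem neighborSum_graphO {M : Type*} [AddCommMonoid M] (f : ONode → M) :
    graphO.neighborSum f = ONode.values (f .n1) (f .n0 + f .n2) (f .n1 + f .n3)
      (f .n2 + f .n4p + f .n4m) (f .n3 + f .n5) (f .n3) (f .n4p + f .n6p) (f .n5) := by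
  ext i
  rw [SimpleGraph.neighborSum, ONode.sum_eq]
  cases i <;> simp [graphO, ONode.values]

theorem neighborSum_graphI {M : Type*} [AddCommMonoid M] (f : INode → M) :
    graphI.neighborSum f = INode.values (f .n1) (f .n0 + f .n2) (f .n1 + f .n3) (f .n2 + f .n4)
      (f .n3 + f .n5) (f .n4 + f .n6p + f .n6m) (f .n5 + f .n7) (f .n5) (f .n6p) := by
  ext i
  rw [SimpleGraph.neighborSum, INode.sum_eq]
  cases i <;> simp [graphI, INode.values]

section Formulas

variable {ι : Type} [Fintype ι] [DecidableEq ι] {Γ : SimpleGraph ι} [DecidableRel Γ.Adj] {o : ι}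

/-- Formulas for the numbers of walks follow from the recursion. -/
theorem walkCount_eq {even odd : ℕ → ι → ℚ} (h2 : ∀ i, (walkCount Γ o 2 i : ℚ) = even 1 i)
    (hodd : ∀ n, Γ.neighborSum (even (n + 1)) = odd (n + 1))
    (heven : ∀ n, Γ.neighborSum (odd (n + 1)) = even (n + 2)) (n : ℕ) (hn : 1 ≤ n) :
    (∀ i, (walkCount Γ o (2 * n) i : ℚ) = even n i) ∧
      ∀ i, (walkCount Γ o (2 * n + 1) i : ℚ) = odd n i := by
  have hstep (k : ℕ) (f : ι → ℚ) (hf : ∀ i, (walkCount Γ o k i : ℚ) = f i) (i : ι) :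
      (walkCount Γ o (k + 1) i : ℚ) = Γ.neighborSum f i := by
    rw [walkCount, SimpleGraph.neighborSum, SimpleGraph.neighborSum, Nat.cast_sum]
    refine Finset.sum_congr rfl fun j _ => ?_
    rw [← hf, apply_ite (Nat.cast : ℕ → ℚ), Nat.cast_zero]
  obtain ⟨n, rfl⟩ := Nat.exists_eq_add_of_le' hn
  induction n with
  -- The induction starts at length 2, because the closed formulas fail at length 0.
  | zero => exact ⟨h2, fun i => by rw [← hodd]; exact hstep 2 _ h2 i⟩
  | succ n ih =>
    have he (i : ι) : (walkCount Γ o (2 * (n + 1 + 1)) i : ℚ) = even (n + 1 + 1) i := by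
      rw [← heven]
      exact hstep _ _ (ih (by lia)).2 i
    exact ⟨he, fun i => by rw [← hodd]; exact hstep _ _ he i⟩

end Formulas

theorem walkCount_graphT (n : ℕ) (hn : 1 ≤ n) :
    (∀ i, (walkCount graphT .n0 (2 * n) i : ℚ) = evenT n i) ∧
      ∀ i, (walkCount graphT .n0 (2 * n + 1) i : ℚ) = oddT n i := by
  refine walkCount_eq (fun i => ?_) (fun n => ?_) (fun n => ?_) n hn
  · simp only [walkCount, neighborSum_graphT]
    cases i <;> simp [TNode.values, evenT] <;> norm_num
  · ext i
    rw [neighborSum_graphT]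
    cases i <;> simp only [TNode.values, evenT, oddT] <;> ring
  · ext i
    rw [neighborSum_graphT]
    cases i <;> simp only [TNode.values, evenT, oddT] <;> ring

theorem walkCount_graphO (n : ℕ) (hn : 1 ≤ n) :
    (∀ i, (walkCount graphO .n0 (2 * n) i : ℚ) = evenO n i) ∧
      ∀ i, (walkCount graphO .n0 (2 * n + 1) i : ℚ) = oddO n i := by
  refine walkCount_eq (fun i => ?_) (fun n => ?_) (fun n => ?_) n hn
  · simp only [walkCount, neighborSum_graphO]
    cases i <;> simp [ONode.values, evenO] <;> norm_num
  · ext i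
    rw [neighborSum_graphO]
    cases i <;> simp only [ONode.values, evenO, oddO] <;> ring
  · ext i
    rw [neighborSum_graphO]
    cases i <;> simp only [ONode.values, evenO, oddO] <;> ring

theorem cast_lucas (n : ℕ) : (lucas (n + 2) : ℚ) = lucas (n + 1) + lucas n := by
  rw [lucas, Nat.cast_add]

theorem walkCount_graphI (n : ℕ) (hn : 1 ≤ n) :
    (∀ i, (walkCount graphI .n0 (2 * n) i : ℚ) = evenI n i) ∧
      ∀ i, (walkCount graphI .n0 (2 * n + 1) i : ℚ) = oddI n i := by
  refine walkCount_eq (fun i => ?_) (fun n => ?_) (fun n => ?_) n hn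
  · simp only [walkCount, neighborSum_graphI]
    cases i <;> simp [INode.values, evenI, lucas] <;> norm_num
  · ext i
    rw [neighborSum_graphI]
    -- With these instances of the Lucas recursion every node becomes a linear identity. The
    -- truncated index `2 * n - 1` in `evenI` is harmless, as it is only used from `n = 1` on.
    have h1 := cast_lucas (2 * n + 1)
    have h2 := cast_lucas (2 * n + 2)
    have h3 : (4 : ℚ) ^ (n + 2) = 4 ^ (n + 1) * 4 := pow_succ 4 (n + 1)
    cases i <;> simp only [INode.values, evenI, oddI, mul_add, mul_one, add_assoc,
      Nat.reduceAdd, show 2 * n + 2 - 1 = 2 * n + 1 from rfl] at * <;> linarith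
  · ext i
    rw [neighborSum_graphI]
    have h1 := cast_lucas (2 * n + 2)
    have h2 := cast_lucas (2 * n + 3)
    have h3 := cast_lucas (2 * n + 1)
    cases i <;> simp only [INode.values, evenI, oddI, mul_add, mul_one, add_assoc,
      Nat.reduceAdd, Nat.reduceMul,
      show 2 * n + 4 - 1 = 2 * n + 3 from rfl] at * <;> linarith

end McKay

namespace McKay

variable {G : Subgroup SU2}

/-! ### Symmetric powers, the branch node and the arms. -/

section Growth

theorem isChar_natural : IsChar (natural G).character := isChar_character _

variable (G) in
/-- The characters of the symmetric powers of the natural module. -/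
def symChar : ℕ → G → ℂ
  | 0 => 1
  | 1 => (natural G).character
  | n + 2 => symChar (n + 1) * (natural G).character - symChar n

theorem symChar_mul (n : ℕ) :
    symChar G (n + 1) * (natural G).character = symChar G n + symChar G (n + 2) := by
  rw [symChar]
  abel

theorem symChar_one (n : ℕ) : symChar G n 1 = (n + 1 : ℕ) := by
  induction n using Nat.twoStepInduction with
  | zero => simp [symChar]
  | one => simp [symChar]
  | more n h1 h2 =>
    simp only [symChar, Pi.sub_apply, Pi.mul_apply, h1, h2, character_natural_one]
    push_cast
    ring

theorem isIrrChar_symChar_zero : IsIrrChar (symChar G 0) := by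
  have h : symChar G 0 = (Representation.trivial ℂ G ℂ).character := by
    ext g
    simp [symChar, character]
  exact isIrrChar_of_apply_one_eq_one (h ▸ isChar_character _) rfl

variable [Fintype G]

/-- An irreducible summand of a character is a constituent. -/
theorem charInner_ne_zero_of_eq_add {f x c : G → ℂ} (hx : IsIrrChar x) (hc : IsChar c)
    (h : f = x + c) : charInner f x ≠ 0 := by
  obtain ⟨n, hn⟩ := hc.exists_charInner hx.isChar
  rw [h, charInner_add_left, hx.charInner_self, hn]
  norm_cast
  lia

/-- A branch of the representation graph: if `p` and `y` are adjacent and the dimension of `y` is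
less than that of `p`, then `y` has at most one further neighbour. -/
theorem isIrrChar_branch {p y : G → ℂ} (hp : IsIrrChar p) (hy : IsIrrChar y)
    (h : charInner (p * (natural G).character) y ≠ 0) {n m : ℕ} (hn : p 1 = n) (hm : y 1 = m) :
    n ≤ 2 * m ∧ (n = 2 * m → y * (natural G).character = p) ∧
      (m < n → n < 2 * m → IsIrrChar (y * (natural G).character - p)) := by
  have hR : IsChar (y * (natural G).character - p) := by
    refine (hy.isChar.mul isChar_natural).sub hp ?_
    rwa [charInner_mul_natural, charInner_comm]
  set R := y * (natural G).character - p with hRdef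
  have hyR : y * (natural G).character = p + R := by rw [hRdef]; abel
  obtain ⟨r, hr⟩ := hR.exists_apply_one
  have hr2 : n + r = 2 * m := by
    have h1 := congrFun hyR 1
    rw [Pi.mul_apply, Pi.add_apply, character_natural_one, hn, hm, hr] at h1
    norm_cast at h1
    lia
  refine ⟨by lia, fun he => ?_, fun hmn hn2 => ?_⟩
  · rw [hyR, hR.eq_zero (by rw [hr, Nat.cast_eq_zero]; lia), add_zero]
  -- By self-duality, `y` occurs in `z χ` for each constituent `z` of `R`, so `z` has degree at
  -- least `m / 2`. Two constituents would give `R` degree at least `m`, but its degree is `2 m - n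
  -- < m`.
  have key (z c : G → ℂ) (hz : IsIrrChar z) (hc : IsChar c) (hzc : R = z + c) (k : ℕ)
      (hk : z 1 = k) : m ≤ 2 * k := by
    have hne : charInner (z * (natural G).character) y ≠ 0 := by
      rw [charInner_mul_natural, charInner_comm]
      refine charInner_ne_zero_of_eq_add hz (hp.isChar.add hc) ?_
      rw [hyR, hzc]
      abel
    obtain ⟨l, hl⟩ := ((hz.isChar.mul isChar_natural).sub hy hne).exists_apply_one
    rw [Pi.sub_apply, Pi.mul_apply, character_natural_one, hk, hm, sub_eq_iff_eq_add] at hl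
    norm_cast at hl
    lia
  have hR0 : R ≠ 0 := by
    intro h0
    rw [h0, Pi.zero_apply, eq_comm, Nat.cast_eq_zero] at hr
    lia
  obtain ⟨z, c, hz, hc, hzc⟩ := hR.exists_add hR0
  rcases eq_or_ne c 0 with hc0 | hc0
  · rwa [hzc, hc0, add_zero]
  · obtain ⟨z', c', hz', hc', hzc'⟩ := hc.exists_add hc0
    obtain ⟨k, hk⟩ := hz.isChar.exists_apply_one
    obtain ⟨k', hk'⟩ := hz'.isChar.exists_apply_one
    obtain ⟨l, hl⟩ := hc'.exists_apply_one
    have h1 := key z c hz hc hzc k hk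
    have h2 := key z' (z + c') hz' (hz.isChar.add hc') (by rw [hzc, hzc']; abel) k' hk'
    have h3 := congrFun hzc 1
    rw [hzc', Pi.add_apply, Pi.add_apply, hr, hk, hk', hl] at h3
    norm_cast at h3
    lia

/-- Separates nodes of equal degree, which dimensions cannot distinguish. -/
theorem ne_of_charInner_add_eq_zero {x y z : G → ℂ} (hx : IsIrrChar x) (hy : IsIrrChar y)
    (hz : IsIrrChar z) (h : charInner (x + y) z = 0) : x ≠ z ∧ y ≠ z := by
  constructor
  · rintro rfl
    exact charInner_ne_zero_of_eq_add hz hy.isChar rfl h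
  · rintro rfl
    exact charInner_ne_zero_of_eq_add hz hx.isChar (add_comm x y) h

/-- By self-adjointness the subtracted term of the recursion is a constituent, so the difference is
a genuine character and no symmetric power need be constructed. -/
theorem isChar_symChar {n : ℕ} (h : ∀ k ≤ n, IsIrrChar (symChar G k)) :
    IsChar (symChar G (n + 1)) := by
  rcases n with _ | n
  · exact isChar_natural
  rw [symChar]
  refine ((h _ le_rfl).isChar.mul isChar_natural).sub (h n (by lia)) ?_
  rw [charInner_mul_natural, charInner_comm]
  rcases n with _ | n
  · rw [show symChar G 0 * (natural G).character = symChar G 1 from one_mul _,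
      (h _ le_rfl).charInner_self]
    exact one_ne_zero
  · exact charInner_ne_zero_of_eq_add (h _ le_rfl) (h n (by lia)).isChar
      (by rw [symChar_mul, add_comm])

theorem isIrrChar_symChar {n : ℕ}
    (h : ∀ k ≤ n, charInner (symChar G k) (symChar G k) = 1) (k : ℕ) (hk : k ≤ n) :
    IsIrrChar (symChar G k) := by
  induction k using Nat.strong_induction_on with
  | _ k ih =>
  rcases k with _ | k
  · exact isIrrChar_symChar_zero
  · exact (isChar_symChar fun j hj => ih j (by lia) (by lia)).isIrrChar (h _ hk)

/-- The first branching of the representation graph. -/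
theorem exists_branching {n : ℕ} (h : ∀ k ≤ n + 1, charInner (symChar G k) (symChar G k) = 1)
    (h2 : charInner (symChar G (n + 2)) (symChar G (n + 2)) = 2) :
    ∃ (x y : G → ℂ) (a b : ℕ), IsIrrChar x ∧ IsIrrChar y ∧ x ≠ y ∧ symChar G (n + 2) = x + y ∧
      x 1 = a ∧ y 1 = b ∧ a + b = n + 3 ∧ b ≤ a ∧ n + 2 ≤ 2 * b ∧
      charInner (symChar G (n + 1) * (natural G).character) x ≠ 0 ∧
      charInner (symChar G (n + 1) * (natural G).character) y ≠ 0 := by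
  have hirr := isIrrChar_symChar h
  obtain ⟨x, y, hx, hy, hxy, he⟩ :=
    (isChar_symChar hirr).exists_add_of_charInner_self_eq_two h2
  obtain ⟨a, ha⟩ := hx.isChar.exists_apply_one
  obtain ⟨b, hb⟩ := hy.isChar.exists_apply_one
  have h0 := (hirr n (by lia)).isChar
  have hcx : charInner (symChar G (n + 1) * (natural G).character) x ≠ 0 :=
    charInner_ne_zero_of_eq_add hx (h0.add hy.isChar) (by rw [symChar_mul, he]; abel)
  have hcy : charInner (symChar G (n + 1) * (natural G).character) y ≠ 0 :=
    charInner_ne_zero_of_eq_add hy (h0.add hx.isChar) (by rw [symChar_mul, he]; abel)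
  -- Both summands are adjacent to a character of degree `n + 2`, so each has at least half that
  -- degree. With `a + b = n + 3` this leaves `2 + 2`, `3 + 2` and `4 + 3` for `n = 1, 2, 4`.
  have ha2 := (isIrrChar_branch (hirr (n + 1) le_rfl) hx hcx (symChar_one _) ha).1
  have hb2 := (isIrrChar_branch (hirr (n + 1) le_rfl) hy hcy (symChar_one _) hb).1
  have hab : a + b = n + 3 := by
    have h1 := congrFun he 1
    rw [symChar_one, Pi.add_apply, ha, hb] at h1
    exact_mod_cast h1.symm
  rcases le_total b a with hle | hle
  · exact ⟨x, y, a, b, hx, hy, hxy, he, ha, hb, hab, hle, hb2, hcx, hcy⟩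
  · exact ⟨y, x, b, a, hy, hx, hxy.symm, he.trans (add_comm x y), hb, ha, by lia, hle, ha2, hcy, hcx⟩

end Growth

/-! ### Construction of the three labellings. -/

theorem IsBinaryTetrahedral.exists_isLabelling [Finite G] (hG : IsBinaryTetrahedral G) :
    ∃ (d : TNode → ℕ) (ρ : (i : TNode) → Representation ℂ G (Fin (d i) → ℂ)),
      IsLabelling G graphT .n0 .n1 d ρ := by
  have := Fintype.ofFinite G
  -- The polynomials supplied below are products of symmetric power characters, written in the
  -- squared trace `s`.
  have hnorm (k : ℕ) (hk : k ≤ 1 + 1) : charInner (symChar G k) (symChar G k) = 1 := by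
    interval_cases k
    · exact isIrrChar_symChar_zero.charInner_self
    · rw [hG.charInner_eq (fun s => s) fun g => ?_]
      · norm_num
      · simp only [symChar, character_natural_inv]
        ring
    · rw [hG.charInner_eq (fun s => s ^ 2 - 2 * s + 1) fun g => ?_]
      · norm_num
      · simp only [symChar, character_natural_inv, Pi.sub_apply, Pi.mul_apply, Pi.one_apply]
        ring
  have hnorm3 : charInner (symChar G 3) (symChar G 3) = 2 := by
    rw [hG.charInner_eq (fun s => s ^ 3 - 4 * s ^ 2 + 4 * s) fun g => ?_]
    · norm_num
    · simp only [symChar, character_natural_inv, Pi.sub_apply, Pi.mul_apply, Pi.one_apply]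
      ring
  have horth : charInner (symChar G 3) (symChar G 1) = 0 := by
    rw [hG.charInner_eq (fun s => s ^ 2 - 2 * s) fun g => ?_]
    · norm_num
    · simp only [symChar, character_natural_inv, Pi.sub_apply, Pi.mul_apply, Pi.one_apply]
      ring
  have hirr := isIrrChar_symChar hnorm
  obtain ⟨x, y, a, b, hx, hy, hxy, he, ha, hb, hab, hba, hb2, hcx, hcy⟩ :=
    exists_branching hnorm hnorm3
  obtain rfl : a = 2 := by lia
  obtain rfl : b = 2 := by lia
  have hu2 := symChar_one (G := G) 2
  have hx4 := (isIrrChar_branch (hirr 2 le_rfl) hx hcx hu2 ha).2.2 (by lia) (by lia)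
  have hy4 := (isIrrChar_branch (hirr 2 le_rfl) hy hcy hu2 hb).2.2 (by lia) (by lia)
  set x4 := x * (natural G).character - symChar G 2 with hx4def
  set y4 := y * (natural G).character - symChar G 2 with hy4def
  have hxχ : x * (natural G).character = symChar G 2 + x4 := by rw [hx4def]; abel
  have hyχ : y * (natural G).character = symChar G 2 + y4 := by rw [hy4def]; abel
  have ha4 : x4 1 = (1 : ℕ) := by
    rw [hx4def, Pi.sub_apply, Pi.mul_apply, ha, character_natural_one, hu2]
    norm_num
  have hb4 : y4 1 = (1 : ℕ) := by
    rw [hy4def, Pi.sub_apply, Pi.mul_apply, hb, character_natural_one, hu2]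
    norm_num
  have hx4χ : x4 * (natural G).character = x :=
    (isIrrChar_branch hx hx4 (charInner_ne_zero_of_eq_add hx4 (hirr 2 le_rfl).isChar
      (hxχ.trans (add_comm _ _))) ha ha4).2.1 rfl
  have hy4χ : y4 * (natural G).character = y :=
    (isIrrChar_branch hy hy4 (charInner_ne_zero_of_eq_add hy4 (hirr 2 le_rfl).isChar
      (hyχ.trans (add_comm _ _))) hb hb4).2.1 rfl
  have h0χ : symChar G 0 * (natural G).character = symChar G 1 := one_mul _
  have hne1 := ne_of_charInner_add_eq_zero hx hy (hirr 1 (by lia)) (he ▸ horth)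
  -- A leaf determines its neighbour on multiplication by `χ`, so leaves with distinct neighbours
  -- are distinct.
  have hne2 : symChar G 0 ≠ x4 := fun h => hne1.1 (by rw [← hx4χ, ← h, h0χ])
  have hne3 : symChar G 0 ≠ y4 := fun h => hne1.2 (by rw [← hy4χ, ← h, h0χ])
  have hne4 : x4 ≠ y4 := fun h => hxy (by rw [← hx4χ, h, hy4χ])
  have hdim (i : TNode) : TNode.values (symChar G 0) (symChar G 1) (symChar G 2) x y x4 y4 i 1 =
      (TNode.values 1 2 3 2 2 1 1 i : ℕ) := by
    cases i <;> first | exact symChar_one _ | assumption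
  refine McKay.exists_isLabelling
    (TNode.values (symChar G 0) (symChar G 1) (symChar G 2) x y x4 y4) ?_ ?_ rfl rfl ?_
  · rintro (_ | _ | _ | _ | _ | _ | _) <;> first | assumption | exact hirr _ (by decide)
  · intro i j h
    have h1 : TNode.values 1 2 3 2 2 1 1 i = TNode.values 1 2 3 2 2 1 1 j := by
      have := hdim i
      rw [h, hdim j, Nat.cast_inj] at this
      exact this.symm
    cases i <;> cases j <;> first
      | rfl
      | exact absurd h1 (by decide)
      | exact absurd h hxy
      | exact absurd h hne1.1
      | exact absurd h hne1.2
      | exact absurd h hne2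
      | exact absurd h hne3
      | exact absurd h hne4
      | exact absurd h.symm hxy
      | exact absurd h.symm hne1.1
      | exact absurd h.symm hne1.2
      | exact absurd h.symm hne2
      | exact absurd h.symm hne3
      | exact absurd h.symm hne4
  · intro i
    rw [neighborSum_graphT]
    cases i
    · exact h0χ
    · exact symChar_mul 0
    · exact (symChar_mul 1).trans (by rw [he, ← add_assoc]; rfl)
    · exact hxχ
    · exact hyχ
    · exact hx4χ
    · exact hy4χ

theorem IsBinaryOctahedral.exists_isLabelling [Finite G] (hG : IsBinaryOctahedral G) :
    ∃ (d : ONode → ℕ) (ρ : (i : ONode) → Representation ℂ G (Fin (d i) → ℂ)),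
      IsLabelling G graphO .n0 .n1 d ρ := by
  have := Fintype.ofFinite G
  have hnorm (k : ℕ) (hk : k ≤ 2 + 1) : charInner (symChar G k) (symChar G k) = 1 := by
    interval_cases k
    · exact isIrrChar_symChar_zero.charInner_self
    · rw [hG.charInner_eq (fun s => s) fun g => ?_]
      · norm_num
      · simp only [symChar, character_natural_inv]
        ring
    · rw [hG.charInner_eq (fun s => s ^ 2 - 2 * s + 1) fun g => ?_]
      · norm_num
      · simp only [symChar, character_natural_inv, Pi.sub_apply, Pi.mul_apply, Pi.one_apply]
        ring
    · rw [hG.charInner_eq (fun s => s ^ 3 - 4 * s ^ 2 + 4 * s) fun g => ?_]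
      · norm_num
      · simp only [symChar, character_natural_inv, Pi.sub_apply, Pi.mul_apply, Pi.one_apply]
        ring
  have hnorm4 : charInner (symChar G 4) (symChar G 4) = 2 := by
    rw [hG.charInner_eq (fun s => s ^ 4 - 6 * s ^ 3 + 11 * s ^ 2 - 6 * s + 1) fun g => ?_]
    · norm_num
    · simp only [symChar, character_natural_inv, Pi.sub_apply, Pi.mul_apply, Pi.one_apply]
      ring
  have horth : charInner (symChar G 4) (symChar G 2) = 0 := by
    rw [hG.charInner_eq (fun s => s ^ 3 - 4 * s ^ 2 + 4 * s - 1) fun g => ?_]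
    · norm_num
    · simp only [symChar, character_natural_inv, Pi.sub_apply, Pi.mul_apply, Pi.one_apply]
      ring
  have hirr := isIrrChar_symChar hnorm
  obtain ⟨x, y, a, b, hx, hy, hxy, he, ha, hb, hab, hba, hb2, hcx, hcy⟩ :=
    exists_branching hnorm hnorm4
  obtain rfl : a = 3 := by lia
  obtain rfl : b = 2 := by lia
  have hu3 := symChar_one (G := G) 3
  have hx5 := (isIrrChar_branch (hirr 3 le_rfl) hx hcx hu3 ha).2.2 (by lia) (by lia)
  have hyχ := (isIrrChar_branch (hirr 3 le_rfl) hy hcy hu3 hb).2.1 rfl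
  set x5 := x * (natural G).character - symChar G 3 with hx5def
  have hxχ : x * (natural G).character = symChar G 3 + x5 := by rw [hx5def]; abel
  have ha5 : x5 1 = (2 : ℕ) := by
    rw [hx5def, Pi.sub_apply, Pi.mul_apply, ha, character_natural_one, hu3]
    norm_num
  have hcx5 := charInner_ne_zero_of_eq_add hx5 (hirr 3 le_rfl).isChar (hxχ.trans (add_comm _ _))
  have hx6 := (isIrrChar_branch hx hx5 hcx5 ha ha5).2.2 (by lia) (by lia)
  set x6 := x5 * (natural G).character - x with hx6def
  have hx5χ : x5 * (natural G).character = x + x6 := by rw [hx6def]; abel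
  have ha6 : x6 1 = (1 : ℕ) := by
    rw [hx6def, Pi.sub_apply, Pi.mul_apply, ha5, character_natural_one, ha]
    norm_num
  have hx6χ : x6 * (natural G).character = x5 :=
    (isIrrChar_branch hx5 hx6 (charInner_ne_zero_of_eq_add hx6 hx.isChar
      (hx5χ.trans (add_comm _ _))) ha5 ha6).2.1 rfl
  have h0χ : symChar G 0 * (natural G).character = symChar G 1 := one_mul _
  have hne_of_dim {u w : G → ℂ} {m n : ℕ} (hu : u 1 = m) (hw : w 1 = n) (h : m ≠ n) : u ≠ w :=
    fun huw => h (by rw [huw, hw, Nat.cast_inj] at hu; exact hu.symm)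
  have hne1 := ne_of_charInner_add_eq_zero hx hy (hirr 2 (by lia)) (he ▸ horth)
  -- Otherwise `symChar G 3 = y χ` would be the reducible `symChar G 0 + symChar G 2`.
  have hne2 : symChar G 1 ≠ y := by
    intro h
    have h3 : symChar G 3 = symChar G 0 + symChar G 2 := by rw [← hyχ, ← h, symChar_mul]
    refine charInner_ne_zero_of_eq_add (hirr 2 (by lia)) (hirr 0 (by lia)).isChar
      (h3.trans (add_comm _ _)) ((hirr 3 le_rfl).charInner_eq_zero (hirr 2 (by lia)) ?_)
    exact hne_of_dim hu3 (symChar_one 2) (by decide)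
  -- Self-adjointness turns the multiplicity of `symChar G 1` in `x χ` into that of `x` in `symChar
  -- G 0 + symChar G 2`, which is zero.
  have hne3 : symChar G 1 ≠ x5 := by
    refine fun h => (ne_of_charInner_add_eq_zero (hirr 3 le_rfl) hx5 (hirr 1 (by lia)) ?_).2 h.symm
    rw [← hxχ, charInner_mul_natural, symChar_mul, charInner_add_right,
      hx.charInner_eq_zero (hirr 2 (by lia)) hne1.1, hx.charInner_eq_zero (hirr 0 (by lia))
      (hne_of_dim ha (symChar_one 0) (by decide)), add_zero]
  have hne4 : x5 ≠ y := by
    refine (ne_of_charInner_add_eq_zero (hirr 3 le_rfl) hx5 hy ?_).2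
    rw [← hxχ, charInner_mul_natural, hyχ, hx.charInner_eq_zero (hirr 3 le_rfl)
      (hne_of_dim ha hu3 (by decide))]
  have hne5 : symChar G 0 ≠ x6 := fun h => hne3 (by rw [← hx6χ, ← h, h0χ])
  have hdim (i : ONode) :
      ONode.values (symChar G 0) (symChar G 1) (symChar G 2) (symChar G 3) x y x5 x6 i 1 =
        (ONode.values 1 2 3 4 3 2 2 1 i : ℕ) := by
    cases i <;> first | exact symChar_one _ | assumption
  refine McKay.exists_isLabelling
    (ONode.values (symChar G 0) (symChar G 1) (symChar G 2) (symChar G 3) x y x5 x6)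
    ?_ ?_ rfl rfl ?_
  · rintro (_ | _ | _ | _ | _ | _ | _ | _) <;> first | assumption | exact hirr _ (by decide)
  · intro i j h
    have h1 : ONode.values 1 2 3 4 3 2 2 1 i = ONode.values 1 2 3 4 3 2 2 1 j := by
      have := hdim i
      rw [h, hdim j, Nat.cast_inj] at this
      exact this.symm
    cases i <;> cases j <;> first
      | rfl
      | exact absurd h1 (by decide)
      | exact absurd h hne1.1
      | exact absurd h hne2
      | exact absurd h hne3
      | exact absurd h hne4
      | exact absurd h hne5
      | exact absurd h.symm hne1.1
      | exact absurd h.symm hne2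
      | exact absurd h.symm hne3
      | exact absurd h.symm hne4
      | exact absurd h.symm hne5
  · intro i
    rw [neighborSum_graphO]
    cases i
    · exact h0χ
    · exact symChar_mul 0
    · exact symChar_mul 1
    · exact (symChar_mul 2).trans (by rw [he, ← add_assoc]; rfl)
    · exact hxχ
    · exact hyχ
    · exact hx5χ
    · exact hx6χ

theorem IsBinaryIcosahedral.exists_isLabelling [Finite G] (hG : IsBinaryIcosahedral G) :
    ∃ (d : INode → ℕ) (ρ : (i : INode) → Representation ℂ G (Fin (d i) → ℂ)),
      IsLabelling G graphI .n0 .n1 d ρ := by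
  have := Fintype.ofFinite G
  obtain ⟨s, t, hst, hst'⟩ : ∃ s t : ℂ, s + t = 3 ∧ s * t = 1 := by
    obtain ⟨r, hr⟩ := IsAlgClosed.exists_pow_nat_eq (5 : ℂ) (zero_lt_two)
    exact ⟨(3 + r) / 2, (3 - r) / 2, by ring, by linear_combination -hr / 4⟩
  have hs2 : s ^ 2 = 3 * s - 1 := by linear_combination s * hst - hst'
  have ht2 : t ^ 2 = 3 * t - 1 := by linear_combination t * hst - hst'
  -- Powers of the roots become linear, with Fibonacci coefficients; symmetric sums then follow from
  -- `s + t = 3`.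
  have hpow (r : ℂ) (h : r ^ 2 = 3 * r - 1) : r ^ 3 = 8 * r - 3 ∧ r ^ 4 = 21 * r - 8 ∧
      r ^ 5 = 55 * r - 21 ∧ r ^ 6 = 144 * r - 55 :=
    ⟨by linear_combination (r + 3) * h, by linear_combination (r ^ 2 + 3 * r + 8) * h,
      by linear_combination (r ^ 3 + 3 * r ^ 2 + 8 * r + 21) * h,
      by linear_combination (r ^ 4 + 3 * r ^ 3 + 8 * r ^ 2 + 21 * r + 55) * h⟩
  obtain ⟨hs3, hs4, hs5, hs6⟩ := hpow s hs2
  obtain ⟨ht3, ht4, ht5, ht6⟩ := hpow t ht2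
  have hnorm (k : ℕ) (hk : k ≤ 4 + 1) : charInner (symChar G k) (symChar G k) = 1 := by
    interval_cases k
    · exact isIrrChar_symChar_zero.charInner_self
    · rw [hG.charInner_eq hst hst' (fun s => s) fun g => ?_]
      · linear_combination (1 / 5) * hst
      · simp only [symChar, character_natural_inv]
        ring
    · rw [hG.charInner_eq hst hst' (fun s => s ^ 2 - 2 * s + 1) fun g => ?_]
      · rw [hs2, ht2]
        linear_combination (1 / 5) * hst
      · simp only [symChar, character_natural_inv, Pi.sub_apply, Pi.mul_apply, Pi.one_apply]
        ring
    · rw [hG.charInner_eq hst hst' (fun s => s ^ 3 - 4 * s ^ 2 + 4 * s) fun g => ?_]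
      · rw [hs2, hs3, ht2, ht3]
        ring
      · simp only [symChar, character_natural_inv, Pi.sub_apply, Pi.mul_apply, Pi.one_apply]
        ring
    · rw [hG.charInner_eq hst hst' (fun s => s ^ 4 - 6 * s ^ 3 + 11 * s ^ 2 - 6 * s + 1) fun g => ?_]
      · rw [hs2, hs3, hs4, ht2, ht3, ht4]
        ring
      · simp only [symChar, character_natural_inv, Pi.sub_apply, Pi.mul_apply, Pi.one_apply]
        ring
    · rw [hG.charInner_eq hst hst' (fun s => s ^ 5 - 8 * s ^ 4 + 22 * s ^ 3 - 24 * s ^ 2 + 9 * s) fun g => ?_]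
      · rw [hs2, hs3, hs4, hs5, ht2, ht3, ht4, ht5]
        ring
      · simp only [symChar, character_natural_inv, Pi.sub_apply, Pi.mul_apply, Pi.one_apply]
        ring
  have hnorm6 : charInner (symChar G 6) (symChar G 6) = 2 := by
    rw [hG.charInner_eq hst hst' (fun s => s ^ 6 - 10 * s ^ 5 + 37 * s ^ 4 - 62 * s ^ 3 + 46 * s ^ 2 - 12 * s + 1) fun g => ?_]
    · rw [hs2, hs3, hs4, hs5, hs6, ht2, ht3, ht4, ht5, ht6]
      linear_combination (1 / 5) * hst
    · simp only [symChar, character_natural_inv, Pi.sub_apply, Pi.mul_apply, Pi.one_apply]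
      ring
  have horth0 : charInner (symChar G 6) (symChar G 0) = 0 := by
    rw [hG.charInner_eq hst hst' (fun s => s ^ 3 - 5 * s ^ 2 + 6 * s - 1) fun g => ?_]
    · rw [hs2, hs3, ht2, ht3]
      linear_combination (-1 / 5) * hst
    · simp only [symChar, Pi.sub_apply, Pi.mul_apply, Pi.one_apply]
      ring
  have horth2 : charInner (symChar G 6) (symChar G 2) = 0 := by
    rw [hG.charInner_eq hst hst' (fun s => s ^ 4 - 6 * s ^ 3 + 11 * s ^ 2 - 7 * s + 1) fun g => ?_]
    · rw [hs2, hs3, hs4, ht2, ht3, ht4]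
      linear_combination (-1 / 5) * hst
    · simp only [symChar, character_natural_inv, Pi.sub_apply, Pi.mul_apply, Pi.one_apply]
      ring
  have hirr := isIrrChar_symChar hnorm
  obtain ⟨x, y, a, b, hx, hy, hxy, he, ha, hb, hab, hba, hb2, hcx, hcy⟩ :=
    exists_branching hnorm hnorm6
  obtain rfl : a = 4 := by lia
  obtain rfl : b = 3 := by lia
  have hu5 := symChar_one (G := G) 5
  have hx7 := (isIrrChar_branch (hirr 5 le_rfl) hx hcx hu5 ha).2.2 (by lia) (by lia)
  have hyχ := (isIrrChar_branch (hirr 5 le_rfl) hy hcy hu5 hb).2.1 rfl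
  set x7 := x * (natural G).character - symChar G 5 with hx7def
  have hxχ : x * (natural G).character = symChar G 5 + x7 := by rw [hx7def]; abel
  have ha7 : x7 1 = (2 : ℕ) := by
    rw [hx7def, Pi.sub_apply, Pi.mul_apply, ha, character_natural_one, hu5]
    norm_num
  have hx7χ : x7 * (natural G).character = x :=
    (isIrrChar_branch hx hx7 (charInner_ne_zero_of_eq_add hx7 (hirr 5 le_rfl).isChar
      (hxχ.trans (add_comm _ _))) ha ha7).2.1 rfl
  have h0χ : symChar G 0 * (natural G).character = symChar G 1 := one_mul _
  have hne_of_dim {u w : G → ℂ} {m n : ℕ} (hu : u 1 = m) (hw : w 1 = n) (h : m ≠ n) : u ≠ w :=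
    fun huw => h (by rw [huw, hw, Nat.cast_inj] at hu; exact hu.symm)
  have hne0 := ne_of_charInner_add_eq_zero hx hy (hirr 0 (by lia)) (he ▸ horth0)
  have hne1 := ne_of_charInner_add_eq_zero hx hy (hirr 2 (by lia)) (he ▸ horth2)
  -- Otherwise `symChar G 5`, of degree 6, would occur in `symChar G 2 + symChar G 4`, whose
  -- constituents have degrees 3 and 5.
  have hne2 : symChar G 3 ≠ x := by
    intro h
    have h3 : symChar G 2 + symChar G 4 = symChar G 5 + x7 := by rw [← symChar_mul, h, hxχ]
    have h5 := charInner_ne_zero_of_eq_add (hirr 5 le_rfl) hx7.isChar h3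
    rw [charInner_add_left, (hirr 2 (by lia)).charInner_eq_zero (hirr 5 le_rfl)
      (hne_of_dim (symChar_one 2) hu5 (by decide)), (hirr 4 (by lia)).charInner_eq_zero
      (hirr 5 le_rfl) (hne_of_dim (symChar_one 4) hu5 (by decide)), add_zero] at h5
    exact h5 rfl
  have hne3 : symChar G 1 ≠ x7 := by
    refine fun h => (ne_of_charInner_add_eq_zero (hirr 5 le_rfl) hx7 (hirr 1 (by lia)) ?_).2 h.symm
    rw [← hxχ, charInner_mul_natural, symChar_mul, charInner_add_right,
      hx.charInner_eq_zero (hirr 2 (by lia)) hne1.1, hx.charInner_eq_zero (hirr 0 (by lia)) hne0.1,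
      add_zero]
  have hdim (i : INode) :
      INode.values (symChar G 0) (symChar G 1) (symChar G 2) (symChar G 3) (symChar G 4)
        (symChar G 5) x y x7 i 1 = (INode.values 1 2 3 4 5 6 4 3 2 i : ℕ) := by
    cases i <;> first | exact symChar_one _ | assumption
  refine McKay.exists_isLabelling
    (INode.values (symChar G 0) (symChar G 1) (symChar G 2) (symChar G 3) (symChar G 4)
      (symChar G 5) x y x7) ?_ ?_ rfl rfl ?_
  · rintro (_ | _ | _ | _ | _ | _ | _ | _ | _) <;> first | assumption | exact hirr _ (by decide)
  · intro i j h
    have h1 : INode.values 1 2 3 4 5 6 4 3 2 i = INode.values 1 2 3 4 5 6 4 3 2 j := by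
      have := hdim i
      rw [h, hdim j, Nat.cast_inj] at this
      exact this.symm
    cases i <;> cases j <;> first
      | rfl
      | exact absurd h1 (by decide)
      | exact absurd h hne1.2
      | exact absurd h hne2
      | exact absurd h hne3
      | exact absurd h.symm hne1.2
      | exact absurd h.symm hne2
      | exact absurd h.symm hne3
  · intro i
    rw [neighborSum_graphI]
    cases i
    · exact h0χ
    · exact symChar_mul 0
    · exact symChar_mul 1
    · exact symChar_mul 2
    · exact symChar_mul 3
    · exact (symChar_mul 4).trans (by rw [he, ← add_assoc]; rfl)
    · exact hxχ
    · exact hyχ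
    · exact hx7χ

end McKay

/-! ### Assembly. -/

namespace McKay

variable {G : Subgroup SU2}

/-- The dimension of the centralizer algebra, and the dimension formulas, follow from the existence
of a labelling and from formulas for the numbers of walks. -/
theorem finrank_and_dimensionFormulas [Finite G] {ι : Type} [Fintype ι] [DecidableEq ι]
    {Γ : SimpleGraph ι} [DecidableRel Γ.Adj] {o v : ι} {k₀ : ℕ} (hk₀ : 2 ≤ k₀)
    {even odd : ℕ → ι → ℚ}
    (hL : ∃ (d : ι → ℕ) (ρ : (i : ι) → Representation ℂ G (Fin (d i) → ℂ)),
      IsLabelling G Γ o v d ρ)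
    (hw : ∀ n, 1 ≤ n → (∀ i, (walkCount Γ o (2 * n) i : ℚ) = even n i) ∧
      ∀ i, (walkCount Γ o (2 * n + 1) i : ℚ) = odd n i) :
    (∀ k, 1 ≤ k → (Module.finrank ℂ (centralizerAlgebra G k) : ℚ) = even k o) ∧
      DimensionFormulas G Γ o v k₀ even odd := by
  refine ⟨fun k hk => ?_, hL, fun d ρ h => ⟨fun n hn => ?_, fun n hn => ?_⟩⟩
  · obtain ⟨d, ρ, h⟩ := hL
    -- The closed walks have length `2 * k`, so the even formula is used at `n = k`.
    rw [h.finrank_centralizerAlgebra, (hw k hk).1]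
  · exact h.hasDimensions _ _ (hw n (by lia)).1
  · exact h.hasDimensions _ _ (hw n (by lia)).2

end McKay

end

theorem mainTheorem5 (G : Subgroup McKay.SU2) :
    (McKay.IsBinaryTetrahedral G →
      (∀ k : ℕ, 1 ≤ k →
        (Module.finrank ℂ (McKay.centralizerAlgebra G k) : ℚ) = (4 ^ k + 8) / 12) ∧
      McKay.DimensionFormulas G McKay.graphT .n0 .n1 2 McKay.evenT McKay.oddT) ∧
    (McKay.IsBinaryOctahedral G →
      (∀ k : ℕ, 1 ≤ k →
        (Module.finrank ℂ (McKay.centralizerAlgebra G k) : ℚ) = (4 ^ k + 6 * 2 ^ k + 8) / 24) ∧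
      McKay.DimensionFormulas G McKay.graphO .n0 .n1 2 McKay.evenO McKay.oddO) ∧
    (McKay.IsBinaryIcosahedral G →
      (∀ k : ℕ, 1 ≤ k →
        (Module.finrank ℂ (McKay.centralizerAlgebra G k) : ℚ) =
          (4 ^ k + 12 * McKay.lucas (2 * k) + 20) / 60) ∧
      McKay.DimensionFormulas G McKay.graphI .n0 .n1 6 McKay.evenI McKay.oddI) := by
  refine ⟨fun hG => ?_, fun hG => ?_, fun hG => ?_⟩
  · have := McKay.IsDoubleCover.finite hG
    exact McKay.finrank_and_dimensionFormulas le_rfl hG.exists_isLabelling McKay.walkCount_graphT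
  · have := McKay.IsDoubleCover.finite hG
    exact McKay.finrank_and_dimensionFormulas le_rfl hG.exists_isLabelling McKay.walkCount_graphO
  · have := McKay.IsDoubleCover.finite hG
    exact McKay.finrank_and_dimensionFormulas (by norm_num) hG.exists_isLabelling
      McKay.walkCount_graphI
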